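/- **Circuits and distinguishers.** Fix a set $\mathcal G$ of elementary quantum gates, i.e. unitaries each acting on a bounded number of qubits, such that the NOT, Hadamard and Toffoli gates can be implemented exactly, up to a global phase, by circuits over $\mathcal G$ with the help of ancilla qubits that start and end in $|0\rangle$ (for example the standard universal gate set $\{H,T,\mathrm{CNOT}\}$). A quantum distinguisher $A$ of size at most $s$ on $n$ qubits is a circuit of at most $s$ gates from $\mathcal G$, acting on the $n$ input qubits together with any number of ancilla qubits initialized to $|0\rangle$, followed by a measurement of the first qubit of the (nonempty) work space in the computational basis. $\mathbb E[A(\rho)]$ denotes the probability that the outcome is $1$ on input $\rho$. Density operators $\rho,\sigma$ on $n$ qubits are $(s,\varepsilon)$-indistinguishable if $|\mathbb E[A(\rho)]-\mathbb E[A(\sigma)]|\le\varepsilon$ for all distinguishers $A$ of size at most $s$. **Relative min-entropies.** For density operators let $D_\infty(\rho\|\sigma)=\inf\{\lambda\in\mathbb R:\rho\le 2^\lambda\sigma\}$ (with $\inf\emptyset=+\infty$). Then * $D^{\mathrm{HILL\text{-}1}}_{s,\varepsilon}(\rho\|\sigma)\le\lambda$ means: there is a density operator $\rho'$ that is $(s,\varepsilon)$-indistinguishable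 from $\rho$ with $D_\infty(\rho'\|\sigma)\le\lambda$. * $D^{\mathrm{HILL\text{-}2}}_{s,\varepsilon}(\rho\|\sigma)\le\lambda$ means: there is a density operator $\sigma'$ that is $(s,\varepsilon)$-indistinguishable from $\sigma$ with $D_\infty(\rho\|\sigma')\le\lambda$. * $D^{\mathrm{metric\text{-}1}}_{s,\varepsilon}(\rho\|\sigma)\le\lambda$ means: for every distinguisher $A$ of size at most $s$ there is a density operator $\rho'$ with $D_\infty(\rho'\|\sigma)\le\lambda$ and $\mathbb E[A(\rho)]-\mathbb E[A(\rho')]<\varepsilon$. * $D^{\mathrm{metric\text{-}2}}_{s,\varepsilon}(\rho\|\sigma)\le\lambda$ means: for every distinguisher $A$ of size at most $s$ there is a density operator $\sigma'$ with $D_\infty(\rho\|\sigma')\le\lambda$ and $\mathbb E[A(\sigma)]-\mathbb E[A(\sigma')]<\varepsilon$. **Theorem.** There is a constant $C>0$, depending only on $\mathcal G$, such that the following holds for every $n\ge 0$, $N=2^n$, all density operators $\rho,\sigma$ on the $N$-dimensional $n$-qubit space, every real $\varepsilon>0$, every $\lambda\in\mathbb R$, every integer $s'\ge 1$ and every integer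 $s\ge s'\cdot C\log_2 N/\varepsilon^2$: 1. if $D^{\mathrm{metric\text{-}1}}_{s,\varepsilon}(\rho\|\sigma)\le\lambda$, then $D^{\mathrm{HILL\text{-}1}}_{s',2\varepsilon}(\rho\|\sigma)\le\lambda$; 2. if $D^{\mathrm{metric\text{-}2}}_{s,\varepsilon}(\rho\|\sigma)\le\lambda$, then $D^{\mathrm{HILL\text{-}2}}_{s',2\varepsilon}(\rho\|\sigma)\le\lambda$. -/

import Mathlib

open scoped ComplexOrder

noncomputable section

/-- The computational basis of an `n`-qubit system. -/
abbrev Qubits (n : ℕ) : Type := Fin n → Fin 2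

/-- Operators on the `n`-qubit space, of dimension `2 ^ n`, in the computational basis. -/
abbrev QOp (n : ℕ) : Type := Matrix (Qubits n) (Qubits n) ℂ

/-- Density operators. -/
def IsDensity {n : ℕ} (ρ : QOp n) : Prop := ρ.PosSemidef ∧ ρ.trace = 1

/-- Quantum relative min-entropy `D_∞(ρ‖σ) = inf {l ∈ ℝ : ρ ≤ 2 ^ l σ}`, with value `⊤` if there is
no such `l`. -/
def relMinEntropy {n : ℕ} (ρ σ : QOp n) : EReal :=
  sInf ((fun l : ℝ => (l : EReal)) '' {l : ℝ | ((((2 : ℝ) ^ l : ℝ) : ℂ) • σ - ρ).PosSemidef})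

/-- A set of elementary quantum gates: a family of unitaries, each acting on a number of qubits that
is bounded by a constant. -/
structure GateSet where
  Gate : Type
  arity : Gate → ℕ
  mat : (g : Gate) → Matrix.unitaryGroup (Qubits (arity g)) ℂ
  bounded : ∃ K : ℕ, ∀ g, arity g ≤ K

/-- A gate of `G` together with the distinct wires it is applied to. -/
structure PlacedGate (G : GateSet) (m : ℕ) where
  gate : G.Gate
  wires : Fin (G.arity gate) ↪ Fin m

/-- The operator on `m` qubits that acts as the gate on its wires and trivially on the others. -/
def PlacedGate.op {G : GateSet} {m : ℕ} (p : PlacedGate G m) : QOp m :=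
  Matrix.of fun x y =>
    if ∀ w, (∀ i, p.wires i ≠ w) → x w = y w then
      (G.mat p.gate : QOp (G.arity p.gate)) (x ∘ p.wires) (y ∘ p.wires)
    else 0

/-- The unitary `U_1 U_2 ⋯ U_s` of a sequence of gates. -/
def circuitOp {G : GateSet} {m : ℕ} (L : List (PlacedGate G m)) : QOp m :=
  (L.map PlacedGate.op).prod

/-- `ρ ⊗ |0^a⟩⟨0^a|`. -/
def withAncilla {n : ℕ} (a : ℕ) (ρ : QOp n) : QOp (n + a) :=
  Matrix.of fun x y =>
    if ∀ i : Fin a, x (Fin.natAdd n i) = 0 ∧ y (Fin.natAdd n i) = 0 then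
      ρ (x ∘ Fin.castAdd a) (y ∘ Fin.castAdd a)
    else 0

/-- A quantum distinguisher on `n` input qubits: a circuit over `G` on the input qubits followed by
`anc` ancilla qubits; after the circuit the first qubit of the (nonempty) work space is measured. -/
structure Distinguisher (G : GateSet) (n : ℕ) where
  anc : ℕ
  pos : 0 < n + anc
  gates : List (PlacedGate G (n + anc))

namespace Distinguisher

variable {G : GateSet} {n : ℕ}

/-- The number of gates. -/
def size (A : Distinguisher G n) : ℕ := A.gates.length

/-- The projection `|1⟩⟨1| ⊗ I` on the first qubit of the work space. -/
def proj (A : Distinguisher G n) : QOp (n + A.anc) :=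
  Matrix.diagonal fun x => if x ⟨0, A.pos⟩ = 1 then 1 else 0

/-- `𝔼[A(ρ)]`, the probability that `A` outputs `1` on input `ρ`, the ancillas being all
initialized to `|0⟩`. -/
def expect (A : Distinguisher G n) (ρ : QOp n) : ℝ :=
  (Matrix.trace
    (A.proj * (circuitOp A.gates * withAncilla A.anc ρ * (circuitOp A.gates).conjTranspose))).re

end Distinguisher

/-- `(s, ε)`-quantum-indistinguishability. -/
def Indist (G : GateSet) {n : ℕ} (s : ℕ) (ε : ℝ) (ρ σ : QOp n) : Prop :=
  ∀ A : Distinguisher G n, A.size ≤ s → |A.expect ρ - A.expect σ| ≤ ε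

/-- `D^{HILL-1}_{s,ε}(ρ‖σ) ≤ l`. -/
def HILL1Le (G : GateSet) {n : ℕ} (s : ℕ) (ε : ℝ) (ρ σ : QOp n) (l : ℝ) : Prop :=
  ∃ ρ' : QOp n, IsDensity ρ' ∧ Indist G s ε ρ ρ' ∧ relMinEntropy ρ' σ ≤ l

/-- `D^{HILL-2}_{s,ε}(ρ‖σ) ≤ l`. -/
def HILL2Le (G : GateSet) {n : ℕ} (s : ℕ) (ε : ℝ) (ρ σ : QOp n) (l : ℝ) : Prop :=
  ∃ σ' : QOp n, IsDensity σ' ∧ Indist G s ε σ σ' ∧ relMinEntropy ρ σ' ≤ l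

/-- `D^{metric-1}_{s,ε}(ρ‖σ) ≤ l`. -/
def Metric1Le (G : GateSet) {n : ℕ} (s : ℕ) (ε : ℝ) (ρ σ : QOp n) (l : ℝ) : Prop :=
  ∀ A : Distinguisher G n, A.size ≤ s →
    ∃ ρ' : QOp n, IsDensity ρ' ∧ relMinEntropy ρ' σ ≤ l ∧ A.expect ρ - A.expect ρ' < ε

/-- `D^{metric-2}_{s,ε}(ρ‖σ) ≤ l`. -/
def Metric2Le (G : GateSet) {n : ℕ} (s : ℕ) (ε : ℝ) (ρ σ : QOp n) (l : ℝ) : Prop :=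
  ∀ A : Distinguisher G n, A.size ≤ s →
    ∃ σ' : QOp n, IsDensity σ' ∧ relMinEntropy ρ σ' ≤ l ∧ A.expect σ - A.expect σ' < ε

/-- The NOT gate. -/
def notGate : QOp 1 := Matrix.of fun x y => if x 0 = y 0 then 0 else 1

/-- The Hadamard gate. -/
def hadamardGate : QOp 1 :=
  Matrix.of fun x y => (if x 0 = 1 ∧ y 0 = 1 then -1 else 1) / ((Real.sqrt 2 : ℝ) : ℂ)

/-- The Toffoli gate `|a, b, c⟩ ↦ |a, b, c ⊕ ab⟩`. -/
def toffoliGate : QOp 3 :=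
  Matrix.of fun x y => if x 0 = y 0 ∧ x 1 = y 1 ∧ x 2 = y 2 + y 0 * y 1 then 1 else 0

/-- Some circuit over `G` implements `U` exactly, up to a global phase, with the help of ancilla
qubits that start in `|0⟩` and are returned to `|0⟩`: it maps `|x⟩|0^a⟩` to `c (U|x⟩)|0^a⟩`. -/
def GateSet.Implements (G : GateSet) {k : ℕ} (U : QOp k) : Prop :=
  ∃ (a : ℕ) (L : List (PlacedGate G (k + a))) (c : ℂ), ‖c‖ = 1 ∧
    ∀ (x : Qubits k) (z : Qubits (k + a)),
      circuitOp L z (Fin.append x (fun _ => 0)) =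
        if ∀ i : Fin a, z (Fin.natAdd k i) = 0 then c * U (z ∘ Fin.castAdd a) x else 0

end

set_option linter.unusedSectionVars false

noncomputable section

/-! Both parts are one separation argument. Let β be the state to be imitated and L the set of
density operators that obey the entropy bound; L is convex and compact. If no τ in L is (s',
2ε)-indistinguishable from β, then every τ is exposed with advantage above 2ε by the effect of a
test of size s' or by its complement. Sion's minimax theorem (`exists_convex_combination`) yields
one finite convex combination of such effects that exposes all of L. A test of size s that imitates
this combination up to ε contradicts the metric hypothesis (`exists_indist`). The bound on s rests
on two ingredients.

Sparsification (`exists_average_close`): a derandomized matrix Chernoff bound. The convex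
combination is within ε/2 in operator norm of a uniform average of O(log N / ε²) of its terms, with
repetitions. The terms are chosen greedily so that tr exp(S) + tr exp(-S) grows slowly, S being the
scaled sum of deviations; the dimension enters only through its logarithm.

Circuits (`ControlledTest.average`): the average is realized with O(s') gates per term. The gates of
`G` need not have controlled versions, so control is obtained by rerouting: a test always runs on a
dummy register, and if its enabling flag is 1, Fredkin gates exchange the dummies with the O(s')
real inputs it touches (`controlledTest_of_supportedOn`). A binary tree of Hadamard coins carries a
single flag to a uniformly random test (`ControlledTest.coin`). All tests run one after the other
and share an output wire; the disabled ones leave every observable on the input unchanged. -/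

/-- Operators on the qubits indexed by `W`, in the computational basis. -/
abbrev WireOp (W : Type) : Type := Matrix (W → Fin 2) (W → Fin 2) ℂ

/-! ### Operators on labelled wires: placement, initialization and permutation of wires -/

section Wires

variable {I V W X : Type} [Fintype I] [DecidableEq I] [Fintype V] [DecidableEq V]
  [Fintype W] [DecidableEq W] [Fintype X] [DecidableEq X]

/-- The operator that acts as `A` on the wires in the range of `i` and trivially elsewhere. -/
def lift (i : V ↪ W) (A : WireOp V) : WireOp W :=
  Matrix.of fun x y => if ∀ w, (∀ v, i v ≠ w) → x w = y w then A (x ∘ i) (y ∘ i) else 0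

/-- The isometry `|v⟩ ↦ |v⟩ ⊗ |z⟩`, where `z` gives the values off the range of `i`. -/
def inc (i : V ↪ W) (z : W → Fin 2) : Matrix (W → Fin 2) (V → Fin 2) ℂ :=
  Matrix.of fun w v => if w = Function.extend i v z then 1 else 0

theorem extend_off (i : V ↪ W) (v : V → Fin 2) (z : W → Fin 2) {w : W} (h : ∀ a, i a ≠ w) :
    Function.extend i v z w = z w :=
  Function.extend_apply' _ _ _ fun ⟨a, ha⟩ => h a ha

theorem extend_comp_self (i : V ↪ W) (v : V → Fin 2) (z : W → Fin 2) :
    Function.extend i v z ∘ i = v := by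
  funext a; simp [i.injective.extend_apply]

theorem eq_extend_iff (i : V ↪ W) (v : V → Fin 2) (z w : W → Fin 2) :
    w = Function.extend i v z ↔ w ∘ i = v ∧ ∀ a, (∀ b, i b ≠ a) → w a = z a := by
  constructor
  · rintro rfl
    exact ⟨extend_comp_self i v z, fun a ha => extend_off i v z ha⟩
  · rintro ⟨rfl, h⟩
    funext a
    by_cases ha : ∃ b, i b = a
    · obtain ⟨b, rfl⟩ := ha
      simp [i.injective.extend_apply]
    · push Not at ha
      rw [extend_off i _ z ha, h a ha]

theorem lift_apply (i : V ↪ W) (A : WireOp V) (x y : W → Fin 2) :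
    lift i A x y = if ∀ w, (∀ v, i v ≠ w) → x w = y w then A (x ∘ i) (y ∘ i) else 0 := rfl

theorem sum_agree (i : V ↪ W) (x : W → Fin 2) (f : (W → Fin 2) → ℂ) :
    (∑ y, if ∀ w, (∀ v, i v ≠ w) → x w = y w then f y else 0)
      = ∑ v : V → Fin 2, f (Function.extend i v x) := by
  rw [← Finset.sum_filter]
  symm
  refine Finset.sum_bij (fun v _ => Function.extend i v x) ?_ ?_ ?_ ?_
  · intro v _
    simp only [Finset.mem_filter, Finset.mem_univ, true_and]
    intro w hw
    rw [extend_off i v x hw]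
  · intro a _ b _ h
    rw [← extend_comp_self i a x, h, extend_comp_self]
  · intro y hy
    simp only [Finset.mem_filter, Finset.mem_univ, true_and] at hy
    exact ⟨y ∘ i, Finset.mem_univ _, ((eq_extend_iff i _ x y).2 ⟨rfl, fun a ha => (hy a ha).symm⟩).symm⟩
  · intros; rfl

theorem lift_mul_apply (i : V ↪ W) (A : WireOp V) {α : Type} (M : Matrix (W → Fin 2) α ℂ)
    (x : W → Fin 2) (y : α) :
    (lift i A * M) x y = ∑ v : V → Fin 2, A (x ∘ i) v * M (Function.extend i v x) y := by
  rw [Matrix.mul_apply]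
  simp only [lift_apply, ite_mul, zero_mul]
  rw [sum_agree i x fun z => A (x ∘ i) (z ∘ i) * M z y]
  simp only [extend_comp_self]

theorem lift_mul (i : V ↪ W) (A B : WireOp V) : lift i (A * B) = lift i A * lift i B := by
  ext x y
  rw [lift_mul_apply, lift_apply, Matrix.mul_apply]
  have (v : V → Fin 2) : (∀ w, (∀ v, i v ≠ w) → Function.extend i v x w = y w) ↔
      ∀ w, (∀ v, i v ≠ w) → x w = y w :=
    forall₂_congr fun w hw => by rw [extend_off i v x hw]
  simp only [lift_apply, this, extend_comp_self]
  split_ifs <;> simp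

@[simp] theorem lift_one (i : V ↪ W) : lift i (1 : WireOp V) = 1 := by
  ext x y
  rw [lift_apply, Matrix.one_apply, Matrix.one_apply]
  by_cases h : x = y
  · subst h; simp
  · rw [if_neg h]
    split_ifs with h1 h2
    · exfalso; apply h
      rw [(eq_extend_iff i (y ∘ i) y x).2 ⟨h2, h1⟩]
      exact ((eq_extend_iff i (y ∘ i) y y).2 ⟨rfl, fun _ _ => rfl⟩).symm
    · rfl
    · rfl

theorem lift_conjTranspose (i : V ↪ W) (A : WireOp V) :
    lift i A.conjTranspose = (lift i A).conjTranspose := by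
  ext x y
  simp only [lift_apply, Matrix.conjTranspose_apply, @eq_comm _ (x _) (y _)]
  split_ifs <;> simp

theorem lift_trans (i : V ↪ W) (j : W ↪ X) (A : WireOp V) :
    lift (i.trans j) A = lift j (lift i A) := by
  ext x y
  simp only [lift_apply, Function.Embedding.trans_apply]
  by_cases h1 : ∀ w, (∀ v, j v ≠ w) → x w = y w
  · rw [if_pos h1]
    refine if_congr ⟨fun h w hw => ?_, fun h w hw => ?_⟩ rfl rfl
    · exact h _ fun v hv => hw v (j.injective hv)
    · by_cases hj : ∃ u, j u = w
      · obtain ⟨u, rfl⟩ := hj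
        exact h u fun v hv => hw v (by rw [hv])
      · push Not at hj
        exact h1 w hj
  · rw [if_neg h1, if_neg]
    intro h
    exact h1 fun w hw => h w fun v => hw _

theorem lift_unitary (i : V ↪ W) {A : WireOp V} (h : A.conjTranspose * A = 1) :
    (lift i A).conjTranspose * lift i A = 1 := by
  rw [← lift_conjTranspose, ← lift_mul, h, lift_one]

theorem lift_mul_lift_apply (i : V ↪ X) (j : W ↪ X) (hij : ∀ v w, i v ≠ j w)
    (A : WireOp V) (B : WireOp W) (x y : X → Fin 2) :
    (lift i A * lift j B) x y =
      if ∀ a, (∀ v, i v ≠ a) → (∀ w, j w ≠ a) → x a = y a then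
        A (x ∘ i) (y ∘ i) * B (x ∘ j) (y ∘ j) else 0 := by
  rw [lift_mul_apply, Finset.sum_eq_single (y ∘ i)]
  · rw [lift_apply]
    have h2 : Function.extend i (y ∘ i) x ∘ j = x ∘ j := by
      funext w; exact extend_off i _ x fun v => hij v w
    rw [h2, mul_ite, mul_zero]
    refine if_congr ⟨fun h a h1 h2 => ?_, fun h a h2 => ?_⟩ rfl rfl
    · rw [← h a h2, extend_off i _ x h1]
    · by_cases hi : ∃ v, i v = a
      · obtain ⟨v, rfl⟩ := hi
        simp [i.injective.extend_apply]
      · push Not at hi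
        rw [extend_off i _ x hi]
        exact h a hi h2
  · intro v _ hv
    rw [lift_apply, if_neg, mul_zero]
    intro h
    apply hv
    funext a
    rw [Function.comp_apply, ← h (i a) fun w hw => hij a w hw.symm, i.injective.extend_apply]
  · simp

theorem lift_comm (i : V ↪ X) (j : W ↪ X) (hij : ∀ v w, i v ≠ j w)
    (A : WireOp V) (B : WireOp W) : lift i A * lift j B = lift j B * lift i A := by
  ext x y
  rw [lift_mul_lift_apply i j hij, lift_mul_lift_apply j i fun w v => (hij v w).symm, mul_comm]
  exact if_congr ⟨fun h a h1 h2 => h a h2 h1, fun h a h1 h2 => h a h2 h1⟩ rfl rfl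

theorem mul_inc_apply (i : V ↪ W) (z : W → Fin 2) {α : Type} (M : Matrix α (W → Fin 2) ℂ)
    (x : α) (v : V → Fin 2) : (M * inc i z) x v = M x (Function.extend i v z) := by
  simp [Matrix.mul_apply, inc]

theorem inc_conj_mul_apply (i : V ↪ W) (z : W → Fin 2) {α : Type} (M : Matrix (W → Fin 2) α ℂ)
    (v : V → Fin 2) (y : α) :
    ((inc i z).conjTranspose * M) v y = M (Function.extend i v z) y := by
  simp [Matrix.mul_apply, inc, apply_ite]

theorem inc_mul_apply (i : V ↪ W) (z : W → Fin 2) {α : Type} (M : Matrix (V → Fin 2) α ℂ)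
    (w : W → Fin 2) (y : α) :
    (inc i z * M) w y = if ∀ a, (∀ b, i b ≠ a) → w a = z a then M (w ∘ i) y else 0 := by
  rw [Matrix.mul_apply, Finset.sum_eq_single (w ∘ i)]
  · simp only [inc, Matrix.of_apply, eq_extend_iff, true_and]
    split_ifs <;> simp
  · intro v _ hv
    simp only [inc, Matrix.of_apply, eq_extend_iff]
    rw [if_neg (fun h => hv h.1.symm), zero_mul]
  · simp

theorem inc_conj_mul_inc (i : V ↪ W) (z : W → Fin 2) :
    (inc i z).conjTranspose * inc i z = 1 := by
  ext x y
  rw [inc_conj_mul_apply]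
  simp only [inc, Matrix.of_apply, Matrix.one_apply]
  refine if_congr ⟨fun h => ?_, fun h => by rw [h]⟩ rfl rfl
  rw [← extend_comp_self i x z, h, extend_comp_self]

theorem inc_trans (i : V ↪ W) (j : W ↪ X) (z : X → Fin 2) :
    inc (i.trans j) z = inc j z * inc i (z ∘ j) := by
  ext x v
  rw [mul_inc_apply]
  simp only [inc, Matrix.of_apply]
  congr 1
  simp only [eq_extend_iff, Function.Embedding.trans_apply, eq_iff_iff]
  constructor
  · rintro ⟨h1, h2⟩
    refine ⟨⟨h1, fun a ha => h2 _ fun b hb => ha b (j.injective hb)⟩, fun a ha => h2 a fun b => ha _⟩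
  · rintro ⟨⟨h1, h2⟩, h3⟩
    refine ⟨h1, fun a ha => ?_⟩
    by_cases hj : ∃ u, j u = a
    · obtain ⟨u, rfl⟩ := hj
      exact h2 u fun v hv => ha v (by rw [hv])
    · push Not at hj
      exact h3 a hj

/-- A relation between an operator and an inclusion persists under adding wires. -/
theorem lift_mul_inc_of_square {j₁ : I ↪ V} {j₂ : I ↪ W} {k₁ : V ↪ X} {k₂ : W ↪ X}
    (hc : ∀ a, k₁ (j₁ a) = k₂ (j₂ a)) (hp : ∀ v w, k₁ v = k₂ w → ∃ a, j₁ a = v ∧ j₂ a = w)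
    (z : X → Fin 2) {Y : WireOp W} {U : WireOp I}
    (h : Y * inc j₂ (z ∘ k₂) = inc j₂ (z ∘ k₂) * U) :
    lift k₂ Y * inc k₁ z = inc k₁ z * lift j₁ U := by
  have key (x : V → Fin 2) :
      Function.extend k₁ x z ∘ k₂ = Function.extend j₂ (x ∘ j₁) (z ∘ k₂) := by
    rw [eq_extend_iff]
    constructor
    · funext a
      simp [← hc, k₁.injective.extend_apply]
    · intro a ha
      refine extend_off k₁ x z fun v hv => ?_
      obtain ⟨b, -, hb⟩ := hp v a hv
      exact ha b hb
  ext w x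
  rw [mul_inc_apply, inc_mul_apply, lift_apply, key, ← mul_inc_apply j₂ (z ∘ k₂) Y, h, inc_mul_apply, lift_apply]
  have e : (w ∘ k₂) ∘ j₂ = (w ∘ k₁) ∘ j₁ := by funext a; simp [hc]
  rw [e, ← ite_and, ← ite_and]
  refine if_congr ⟨?_, ?_⟩ rfl rfl
  · rintro ⟨h1, h2⟩
    constructor
    · intro a ha
      by_cases hk : ∃ u, k₂ u = a
      · obtain ⟨u, rfl⟩ := hk
        exact h2 u fun b hb => ha (j₁ b) (by rw [hc, hb])
      · push Not at hk
        rw [h1 a hk, extend_off k₁ x z ha]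
    · intro v hv
      rw [Function.comp_apply, h1, k₁.injective.extend_apply]
      intro u hu
      obtain ⟨a, ha, -⟩ := hp v u hu.symm
      exact hv a ha
  · rintro ⟨h1, h2⟩
    constructor
    · intro a ha
      by_cases hk : ∃ u, k₁ u = a
      · obtain ⟨u, rfl⟩ := hk
        rw [k₁.injective.extend_apply]
        exact h2 u fun b hb => ha (j₂ b) (by rw [← hc, hb])
      · push Not at hk
        rw [h1 a hk, extend_off k₁ x z hk]
    · intro v hv
      refine h1 _ fun u hu => ?_
      obtain ⟨a, -, ha⟩ := hp u v hu
      exact hv a ha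

/-- The case of a square with identity legs: no initialized wire is touched. -/
theorem lift_mul_inc (i : V ↪ W) (A : WireOp V) (z : W → Fin 2) :
    lift i A * inc i z = inc i z * A := by
  have h := lift_mul_inc_of_square (j₁ := Function.Embedding.refl V)
    (j₂ := Function.Embedding.refl V) (k₁ := i) (k₂ := i) (fun _ => rfl)
    (fun v w h => ⟨v, rfl, i.injective h⟩) z (Y := A) (U := A) (by
      ext x y
      rw [mul_inc_apply, inc_mul_apply, if_pos (fun a ha => absurd rfl (ha a))]
      congr 1
      exact ((eq_extend_iff (Function.Embedding.refl V) y _ y).2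
        ⟨rfl, fun a ha => absurd rfl (ha a)⟩).symm)
  rw [h]
  congr 1
  ext x y
  rw [lift_apply, if_pos (fun a ha => absurd rfl (ha a))]
  rfl

/-- Initialising wires on which `Y` partly acts: the square version. -/
theorem inc_conj_lift_inc_of_square {j₁ : I ↪ V} {j₂ : I ↪ W} {k₁ : V ↪ X} {k₂ : W ↪ X}
    (hc : ∀ a, k₁ (j₁ a) = k₂ (j₂ a)) (hp : ∀ v w, k₁ v = k₂ w → ∃ a, j₁ a = v ∧ j₂ a = w)
    (z : X → Fin 2) (Y : WireOp W) :
    (inc k₁ z).conjTranspose * lift k₂ Y * inc k₁ z =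
      lift j₁ ((inc j₂ (z ∘ k₂)).conjTranspose * Y * inc j₂ (z ∘ k₂)) := by
  have key (x : V → Fin 2) :
      Function.extend k₁ x z ∘ k₂ = Function.extend j₂ (x ∘ j₁) (z ∘ k₂) := by
    rw [eq_extend_iff]
    constructor
    · funext a
      simp [← hc, k₁.injective.extend_apply]
    · intro a ha
      refine extend_off k₁ x z fun v hv => ?_
      obtain ⟨b, -, hb⟩ := hp v a hv
      exact ha b hb
  ext x y
  rw [mul_inc_apply, inc_conj_mul_apply, lift_apply, lift_apply, mul_inc_apply,
    inc_conj_mul_apply, key, key]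
  refine if_congr ⟨fun h v hv => ?_, fun h w hw => ?_⟩ rfl rfl
  · have := h (k₁ v) fun w hw => by
      obtain ⟨a, ha, -⟩ := hp v w hw.symm
      exact hv a ha
    simpa [k₁.injective.extend_apply] using this
  · by_cases hk : ∃ u, k₁ u = w
    · obtain ⟨u, rfl⟩ := hk
      rw [k₁.injective.extend_apply, k₁.injective.extend_apply]
      exact h u fun b hb => hw (j₂ b) (by rw [← hc, hb])
    · push Not at hk
      rw [extend_off k₁ x z hk, extend_off k₁ y z hk]

/-- An untouched wire with different basis values in the two branches keeps them orthogonal. This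
removes the interference terms of a coin toss. -/
theorem inc_conj_lift_inc_eq_zero (i : V ↪ X) (k : W ↪ X) (Y : WireOp W) {z z' : X → Fin 2}
    {a : X} (hi : ∀ v, i v ≠ a) (hk : ∀ w, k w ≠ a) (hz : z a ≠ z' a) :
    (inc i z).conjTranspose * lift k Y * inc i z' = 0 := by
  ext x y
  rw [mul_inc_apply, inc_conj_mul_apply, lift_apply, if_neg, Matrix.zero_apply]
  intro h
  apply hz
  rw [← extend_off i x z hi, h a hk, extend_off i y z' hi]

/-- An operator on initialized wires only turns one initialization into a superposition of
initializations. Applied to the Hadamard gate, it produces a coin. -/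
theorem lift_mul_inc_of_disjoint (f : V ↪ X) (i : W ↪ X) (hd : ∀ v w, f v ≠ i w) (S : WireOp V)
    (z : X → Fin 2) :
    lift f S * inc i z = ∑ u : V → Fin 2, S u (z ∘ f) • inc i (Function.extend f u z) := by
  ext w x
  rw [mul_inc_apply, lift_apply, Matrix.sum_apply]
  have e : Function.extend i x z ∘ f = z ∘ f := by
    funext v; exact extend_off i x z fun w h => hd v w h.symm
  rw [e, Finset.sum_eq_single (w ∘ f)]
  · simp only [Matrix.smul_apply, inc, Matrix.of_apply, smul_eq_mul, mul_ite, mul_one, mul_zero,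
      eq_extend_iff]
    refine if_congr ⟨fun h => ⟨?_, fun a ha => ?_⟩, fun h a ha => ?_⟩ rfl rfl
    · funext a
      rw [Function.comp_apply, h _ fun v => hd v a, i.injective.extend_apply]
    · by_cases hf : ∃ v, f v = a
      · obtain ⟨v, rfl⟩ := hf
        rw [f.injective.extend_apply]; rfl
      · push Not at hf
        rw [h a hf, extend_off i x z ha, extend_off f _ z hf]
    · by_cases hi : ∃ v, i v = a
      · obtain ⟨v, rfl⟩ := hi
        rw [i.injective.extend_apply, ← h.1]; rfl
      · push Not at hi
        rw [h.2 a hi, extend_off i x z hi, extend_off f _ z ha]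
  · intro u _ hu
    simp only [Matrix.smul_apply, inc, Matrix.of_apply, smul_eq_mul, mul_ite, mul_one, mul_zero,
      eq_extend_iff]
    rw [if_neg]
    rintro ⟨-, h⟩
    apply hu
    funext v
    rw [Function.comp_apply, h _ fun w hw => hd v w hw.symm, f.injective.extend_apply]
  · simp

/-- The projection `|1⟩⟨1|` on the wire `w`. -/
def measOp (w : W) : WireOp W := Matrix.diagonal fun x => if x w = 1 then 1 else 0

theorem lift_diagonal (i : V ↪ W) (d : (V → Fin 2) → ℂ) :
    lift i (Matrix.diagonal d) = Matrix.diagonal fun x => d (x ∘ i) := by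
  ext x y
  rw [lift_apply]
  by_cases h : x = y
  · subst h; simp
  · rw [Matrix.diagonal_apply_ne _ h]
    split_ifs with h1
    · apply Matrix.diagonal_apply_ne
      intro h2
      apply h
      rw [(eq_extend_iff i (y ∘ i) y x).2 ⟨h2, h1⟩]
      exact ((eq_extend_iff i (y ∘ i) y y).2 ⟨rfl, fun _ _ => rfl⟩).symm
    · rfl

theorem lift_measOp (i : V ↪ W) (v : V) : lift i (measOp v) = measOp (i v) :=
  lift_diagonal _ _

theorem measOp_mul_inc (i : V ↪ W) (z : W → Fin 2) {w : W} (hw : ∀ v, i v ≠ w) :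
    measOp w * inc i z = (if z w = 1 then (1 : ℂ) else 0) • inc i z := by
  ext x y
  rw [measOp, Matrix.diagonal_mul, Matrix.smul_apply, smul_eq_mul]
  by_cases h : x = Function.extend i y z
  · rw [h, extend_off i y z hw]
  · simp [inc, h]

theorem measOp_comm_lift (i : V ↪ W) (A : WireOp V) {w : W} (hw : ∀ v, i v ≠ w) :
    measOp w * lift i A = lift i A * measOp w := by
  have h := lift_measOp (V := Unit) (⟨fun _ => w, fun _ _ _ => rfl⟩ : Unit ↪ W) ()
  change _ = measOp w at h
  rw [← h]
  exact lift_comm _ _ (fun _ v => (hw v).symm) _ _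

/-- The operator of a map of computational basis states. -/
def basisMap (g : (W → Fin 2) → (W → Fin 2)) : WireOp W :=
  Matrix.of fun x y => if x = g y then 1 else 0

theorem basisMap_mul (g h : (W → Fin 2) → (W → Fin 2)) :
    basisMap g * basisMap h = basisMap (g ∘ h) := by
  ext x y
  simp [Matrix.mul_apply, basisMap]

theorem mul_basisMap_apply (M : WireOp W) (g : (W → Fin 2) → (W → Fin 2)) (x y : W → Fin 2) :
    (M * basisMap g) x y = M x (g y) := by
  simp [Matrix.mul_apply, basisMap]

theorem lift_basisMap (i : V ↪ W) (g : (V → Fin 2) → (V → Fin 2)) :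
    lift i (basisMap g) = basisMap fun y => Function.extend i (g (y ∘ i)) y := by
  ext x y
  simp only [lift_apply, basisMap, Matrix.of_apply, eq_extend_iff, ← ite_and]
  exact if_congr and_comm rfl rfl

/-- Rerouting: permuting the wires before and after an operation is the same as placing the
operation on the permuted wires. -/
theorem wirePerm_conj_lift (σ : Equiv.Perm W) (hσ : ∀ w, σ (σ w) = w) (i j : V ↪ W)
    (hij : ∀ v, σ (i v) = j v) (A : WireOp V) :
    basisMap (fun x => x ∘ σ) * lift i A * basisMap (fun x => x ∘ σ) = lift j A := by
  have hs (x : W → Fin 2) : (x ∘ σ) ∘ σ = x := by funext w; simp [hσ]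
  ext x y
  rw [mul_basisMap_apply, Matrix.mul_apply, Finset.sum_eq_single (x ∘ σ)]
  · have e (x : W → Fin 2) : (x ∘ σ) ∘ i = x ∘ j := by funext v; simp [hij]
    simp only [basisMap, Matrix.of_apply, hs, if_true, one_mul, lift_apply, e]
    refine if_congr ⟨fun h w hw => ?_, fun h w hw => ?_⟩ rfl rfl
    · have := h (σ w) fun v hv => hw v (by rw [← hij, hv, hσ])
      simpa [hσ] using this
    · exact h (σ w) fun v hv => hw v (σ.injective (by rw [hij, hv]))
  · intro u _ hu
    simp only [basisMap, Matrix.of_apply]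
    rw [if_neg, zero_mul]
    intro h
    exact hu (by rw [h, hs])
  · simp

end Wires

/-! ### Circuits on labelled wires and exact implementation with clean ancillas -/

/-- A gate of `G` together with the distinct wires of `W` it is applied to. -/
structure WireGate (G : GateSet) (W : Type) where
  gate : G.Gate
  wires : Fin (G.arity gate) ↪ W

/-- The wires of `W`, followed by the ancillas `A`. -/
abbrev inputs (W A : Type) : W ↪ W ⊕ A := Function.Embedding.inl

section Circuits

variable {G : GateSet} {I V W X : Type} [Fintype I] [DecidableEq I] [Fintype V] [DecidableEq V]
  [Fintype W] [DecidableEq W] [Fintype X] [DecidableEq X]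

/-- The operator of a placed gate. -/
def WireGate.op (p : WireGate G W) : WireOp W := lift p.wires (G.mat p.gate : QOp (G.arity p.gate))

/-- Relabelling of the wires. -/
def WireGate.map (i : W ↪ X) (p : WireGate G W) : WireGate G X := ⟨p.gate, p.wires.trans i⟩

/-- The operator of a sequence of placed gates. -/
def wireCircuitOp (L : List (WireGate G W)) : WireOp W := (L.map WireGate.op).prod

theorem wireCircuitOp_append (L L' : List (WireGate G W)) :
    wireCircuitOp (L ++ L') = wireCircuitOp L * wireCircuitOp L' := by
  simp [wireCircuitOp]

theorem wireCircuitOp_cons (p : WireGate G W) (L : List (WireGate G W)) :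
    wireCircuitOp (p :: L) = p.op * wireCircuitOp L := by
  simp [wireCircuitOp]

@[simp] theorem wireCircuitOp_nil : wireCircuitOp ([] : List (WireGate G W)) = 1 := rfl

theorem wireCircuitOp_map (i : W ↪ X) (L : List (WireGate G W)) :
    wireCircuitOp (L.map (WireGate.map i)) = lift i (wireCircuitOp L) := by
  induction L with
  | nil => simp
  | cons p L ih =>
    rw [List.map_cons, wireCircuitOp_cons, wireCircuitOp_cons, ih, lift_mul]
    congr 1
    exact lift_trans _ _ _

theorem WireGate.op_unitary (p : WireGate G W) : p.op.conjTranspose * p.op = 1 :=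
  lift_unitary _ (Matrix.mem_unitaryGroup_iff'.1 (G.mat p.gate).2)

theorem wireCircuitOp_unitary (L : List (WireGate G W)) :
    (wireCircuitOp L).conjTranspose * wireCircuitOp L = 1 := by
  induction L with
  | nil => simp
  | cons p L ih =>
    rw [wireCircuitOp_cons, Matrix.conjTranspose_mul, Matrix.mul_assoc,
      ← Matrix.mul_assoc _ p.op, p.op_unitary, Matrix.one_mul, ih]

/-- A placed gate on `m` qubits, seen as one on the wires `Fin m`. -/
def PlacedGate.toWireGate {m : ℕ} (p : PlacedGate G m) : WireGate G (Fin m) := ⟨p.gate, p.wires⟩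

/-- A placed gate on the wires `Fin m`. -/
def WireGate.toPlacedGate {m : ℕ} (p : WireGate G (Fin m)) : PlacedGate G m := ⟨p.gate, p.wires⟩

theorem PlacedGate.op_toWireGate {m : ℕ} (p : PlacedGate G m) : p.toWireGate.op = p.op := by
  ext x y
  simp only [WireGate.op, lift_apply, PlacedGate.op, Matrix.of_apply, PlacedGate.toWireGate]
  congr

theorem WireGate.op_toPlacedGate {m : ℕ} (p : WireGate G (Fin m)) : p.toPlacedGate.op = p.op :=
  (PlacedGate.op_toWireGate p.toPlacedGate).symm

theorem wireCircuitOp_toWireGate {m : ℕ} (L : List (PlacedGate G m)) :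
    wireCircuitOp (L.map PlacedGate.toWireGate) = circuitOp L := by
  simp only [wireCircuitOp, circuitOp, List.map_map]
  congr 1
  exact List.map_congr_left fun p _ => p.op_toWireGate

theorem circuitOp_toPlacedGate {m : ℕ} (L : List (WireGate G (Fin m))) :
    circuitOp (L.map WireGate.toPlacedGate) = wireCircuitOp L := by
  simp only [wireCircuitOp, circuitOp, List.map_map]
  congr 1
  exact List.map_congr_left fun p _ => p.op_toPlacedGate

variable (G) in
/-- Some circuit of at most `c` gates implements `U` exactly, up to a global phase, with the help of
ancillas that start in `|0⟩` and are returned to `|0⟩`. -/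
def ImplWithin (c : ℕ) (U : WireOp W) : Prop :=
  ∃ (A : Type) (_ : Fintype A) (_ : DecidableEq A) (L : List (WireGate G (W ⊕ A))) (φ : ℂ),
    L.length ≤ c ∧ ‖φ‖ = 1 ∧
      wireCircuitOp L * inc (inputs W A) 0 = inc (inputs W A) 0 * (φ • U)

theorem ImplWithin.mono {c c' : ℕ} {U : WireOp W} (h : ImplWithin G c U) (hc : c ≤ c') :
    ImplWithin G c' U := by
  obtain ⟨A, _, _, L, φ, h1, h2⟩ := h
  exact ⟨A, _, _, L, φ, h1.trans hc, h2⟩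

theorem ImplWithin.one : ImplWithin G 0 (1 : WireOp W) :=
  ⟨Empty, inferInstance, inferInstance, [], 1, le_rfl, by simp, by
    rw [wireCircuitOp_nil, one_smul, Matrix.one_mul, Matrix.mul_one]⟩

/-- Each circuit gets its own ancillas, which the other does not see; the phases multiply. Ancillas
are not counted in the size, so nothing is lost. -/
theorem ImplWithin.mul {c c' : ℕ} {U U' : WireOp W} (h : ImplWithin G c U)
    (h' : ImplWithin G c' U') : ImplWithin G (c + c') (U * U') := by
  obtain ⟨A, _, _, L, φ, h1, h2, h3⟩ := h
  obtain ⟨A', _, _, L', φ', h1', h2', h3'⟩ := h'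
  let i : W ⊕ A ↪ W ⊕ (A ⊕ A') := (Function.Embedding.refl W).sumMap Function.Embedding.inl
  let i' : W ⊕ A' ↪ W ⊕ (A ⊕ A') := (Function.Embedding.refl W).sumMap Function.Embedding.inr
  refine ⟨A ⊕ A', inferInstance, inferInstance, L.map (.map i) ++ L'.map (.map i'), φ * φ', ?_, ?_, ?_⟩
  · simp; omega
  · simp [h2, h2']
  · have k : wireCircuitOp (L.map (.map i)) * inc (inputs W (A ⊕ A')) 0 =
        inc (inputs W (A ⊕ A')) 0 * (φ • U) := by
      have e : inputs W (A ⊕ A') = (inputs W A).trans i := rfl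
      rw [wireCircuitOp_map, e, inc_trans, ← Matrix.mul_assoc, lift_mul_inc, Matrix.mul_assoc,
        Matrix.mul_assoc]
      exact congrArg _ h3
    have k' : wireCircuitOp (L'.map (.map i')) * inc (inputs W (A ⊕ A')) 0 =
        inc (inputs W (A ⊕ A')) 0 * (φ' • U') := by
      have e : inputs W (A ⊕ A') = (inputs W A').trans i' := rfl
      rw [wireCircuitOp_map, e, inc_trans, ← Matrix.mul_assoc, lift_mul_inc, Matrix.mul_assoc,
        Matrix.mul_assoc]
      exact congrArg _ h3'
    rw [wireCircuitOp_append, Matrix.mul_assoc, k', ← Matrix.mul_assoc, k, Matrix.mul_assoc]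
    simp only [Matrix.smul_mul, Matrix.mul_smul, smul_smul, mul_comm φ]

theorem ImplWithin.lift_op {c : ℕ} {U : WireOp W} (h : ImplWithin G c U) (i : W ↪ X) :
    ImplWithin G c (lift i U) := by
  obtain ⟨A, _, _, L, φ, h1, h2, h3⟩ := h
  let k : W ⊕ A ↪ X ⊕ A := i.sumMap (Function.Embedding.refl A)
  refine ⟨A, inferInstance, inferInstance, L.map (.map k), φ, by simpa using h1, h2, ?_⟩
  have e : lift i (φ • U) = φ • lift i U := by
    ext x y; simp [lift_apply]
  rw [wireCircuitOp_map, ← e]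
  refine lift_mul_inc_of_square (j₁ := i) (j₂ := inputs W A) (k₁ := inputs X A) (k₂ := k)
    (fun _ => rfl) ?_ 0 h3
  rintro v (w | w) hw
  · exact ⟨w, (Sum.inl_injective hw).symm, rfl⟩
  · exact absurd hw (by simp [k])

theorem WireGate.implWithin (p : WireGate G W) : ImplWithin G 1 p.op := by
  refine ⟨Empty, inferInstance, inferInstance, [p.map (inputs W Empty)], 1, le_rfl, by simp, ?_⟩
  have h := wireCircuitOp_map (inputs W Empty) [p]
  rw [List.map_singleton] at h
  rw [h, lift_mul_inc, one_smul]
  simp [wireCircuitOp]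

theorem wireCircuitOp_implWithin (L : List (WireGate G W)) :
    ImplWithin G L.length (wireCircuitOp L) := by
  induction L with
  | nil => exact ImplWithin.one
  | cons p L ih =>
    rw [wireCircuitOp_cons, List.length_cons, add_comm]
    exact p.implWithin.mul ih

theorem GateSet.Implements.exists_implWithin {k : ℕ} {U : QOp k} (h : G.Implements U) :
    ∃ c, ImplWithin G c U := by
  obtain ⟨a, L, φ, h1, h2⟩ := h
  let e : Fin (k + a) ↪ Fin k ⊕ Fin a := finSumFinEquiv.symm.toEmbedding
  refine ⟨L.length, Fin a, inferInstance, inferInstance,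
    (L.map PlacedGate.toWireGate).map (.map e), φ, by simp, h1, ?_⟩
  rw [wireCircuitOp_map, wireCircuitOp_toWireGate]
  ext x y
  rw [mul_inc_apply, inc_mul_apply, lift_apply,
    if_pos fun w hw => absurd (finSumFinEquiv.symm_apply_apply w) (hw _)]
  have e1 : Function.extend (inputs (Fin k) (Fin a)) y 0 ∘ e = Fin.append y (fun _ => 0) := by
    rw [← Fin.append_castAdd_natAdd (f := _ ∘ e)]
    congr 1
    · funext i
      have h : e (Fin.castAdd a i) = inputs (Fin k) (Fin a) i := by simp [e]
      rw [Function.comp_apply, h, (inputs (Fin k) (Fin a)).injective.extend_apply]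
    · funext i; simp [e]
  have e2 : (x ∘ e) ∘ Fin.castAdd a = x ∘ inputs (Fin k) (Fin a) := by
    funext i; simp [e]
  rw [e1, h2, e2]
  simp [e]

end Circuits

/-! ### Controlled swaps and coins -/

section Controlled

variable {G : GateSet} {I A V W X : Type} [Fintype I] [DecidableEq I] [Fintype A] [DecidableEq A]
  [Fintype V] [DecidableEq V] [Fintype W] [DecidableEq W] [Fintype X] [DecidableEq X]

/-- The controlled swap of the wires `a` and `b`, on basis states. -/
def controlledSwap (e a b : W) (x : W → Fin 2) : W → Fin 2 :=
  if x e = 1 then x ∘ Equiv.swap a b else x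

theorem lift_controlledSwap (f : V ↪ W) (e a b : V) :
    lift f (basisMap (controlledSwap e a b)) =
      basisMap (controlledSwap (f e) (f a) (f b)) := by
  rw [lift_basisMap]
  congr 1
  funext y
  symm
  rw [eq_extend_iff]
  unfold controlledSwap
  by_cases h : y (f e) = 1
  · rw [if_pos h, if_pos (by simpa using h)]
    refine ⟨?_, fun w hw => ?_⟩
    · funext v
      simp only [Function.comp_apply, Equiv.swap_apply_def, f.injective.eq_iff]
      split_ifs <;> rfl
    · rw [Function.comp_apply, Equiv.swap_apply_of_ne_of_ne (hw a).symm (hw b).symm]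
  · rw [if_neg h, if_neg (by simpa using h)]
    exact ⟨rfl, fun _ _ => rfl⟩

/-- A swap is three CNOT gates with alternating targets; adding the control turns each of them into
a Toffoli gate. -/
theorem fredkin_eq_toffoli :
    (basisMap (controlledSwap 0 1 2) : WireOp (Fin 3)) =
      toffoliGate * lift (Equiv.swap (1 : Fin 3) 2).toEmbedding toffoliGate * toffoliGate := by
  have h : toffoliGate = basisMap fun y : Fin 3 → Fin 2 => ![y 0, y 1, y 2 + y 0 * y 1] := by
    ext x y
    simp only [toffoliGate, basisMap, Matrix.of_apply, funext_iff, Fin.forall_fin_succ]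
    simp
  have h' : lift (Equiv.swap (1 : Fin 3) 2).toEmbedding toffoliGate =
      basisMap fun y : Fin 3 → Fin 2 => ![y 0, y 1 + y 0 * y 2, y 2] := by
    ext x y
    simp only [lift_apply, toffoliGate, basisMap, Matrix.of_apply, ← ite_and]
    refine if_congr ?_ rfl rfl
    revert x y
    decide
  rw [h', h, basisMap_mul, basisMap_mul]
  congr 1
  funext y
  revert y
  decide

theorem exists_fredkin_implWithin (h : G.Implements toffoliGate) :
    ∃ c, ImplWithin G c (basisMap (controlledSwap 0 1 2) : WireOp (Fin 3)) := by
  obtain ⟨c, hc⟩ := h.exists_implWithin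
  rw [fredkin_eq_toffoli]
  exact ⟨_, (hc.mul (hc.lift_op _)).mul hc⟩

theorem controlledSwap_implWithin {c : ℕ}
    (h : ImplWithin G c (basisMap (controlledSwap 0 1 2) : WireOp (Fin 3))) {e a b : W}
    (hea : e ≠ a) (heb : e ≠ b) (hab : a ≠ b) :
    ImplWithin G c (basisMap (controlledSwap e a b)) := by
  have hf : Function.Injective ![e, a, b] := by
    intro i j hij
    fin_cases i <;> fin_cases j <;> simp_all
  have := h.lift_op ⟨_, hf⟩
  rw [lift_controlledSwap] at this
  exact this

theorem controlledSwap_mul_inc (i : V ↪ W) (z : W → Fin 2) {e a b : W} (he : ∀ v, i v ≠ e)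
    (ha : ∀ v, i v ≠ a) (hb : ∀ v, i v ≠ b) :
    basisMap (controlledSwap e a b) * inc i z = inc i (controlledSwap e a b z) := by
  have key (v : V → Fin 2) : controlledSwap e a b (Function.extend i v z) =
      Function.extend i v (controlledSwap e a b z) := by
    rw [eq_extend_iff]
    unfold controlledSwap
    rw [extend_off i v z he]
    split_ifs
    · refine ⟨?_, fun w hw => ?_⟩
      · funext u
        rw [Function.comp_apply, Function.comp_apply,
          Equiv.swap_apply_of_ne_of_ne (ha u) (hb u), i.injective.extend_apply]
      · rw [Function.comp_apply, Function.comp_apply, extend_off i v z]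
        intro u hu
        rw [eq_comm, Equiv.swap_apply_eq_iff, Equiv.swap_apply_of_ne_of_ne (ha u) (hb u)] at hu
        exact hw u hu.symm
    · exact ⟨extend_comp_self i v z, fun w hw => extend_off i v z hw⟩
  ext x v
  rw [mul_inc_apply]
  simp only [inc, basisMap, Matrix.of_apply, key]

/-- The wire `b`, as the wire of a one-qubit gate. -/
def oneWire (b : W) : Fin 1 ↪ W where
  toFun _ := b
  inj' _ _ _ := Subsingleton.elim _ _

@[simp] theorem oneWire_apply (b : W) (j : Fin 1) : oneWire b j = b := rfl

/-- The Hadamard gate on the wire `b`. -/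
def hadamardOn (b : W) : WireOp W := lift (oneWire b) hadamardGate

theorem hadamardOn_mul_inc (i : V ↪ W) (z : W → Fin 2) {b : W} (hb : ∀ v, i v ≠ b)
    (hz : z b = 0) :
    hadamardOn b * inc i z =
      (((Real.sqrt 2 : ℝ) : ℂ)⁻¹) • (inc i z + inc i (Function.update z b 1)) := by
  rw [hadamardOn, lift_mul_inc_of_disjoint _ _ fun _ v => (hb v).symm,
    ← (Equiv.funUnique (Fin 1) (Fin 2)).symm.sum_comp, Fin.sum_univ_two, smul_add]
  have h (c : Fin 2) : Function.extend (oneWire b)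
      ((Equiv.funUnique (Fin 1) (Fin 2)).symm c) z = Function.update z b c := by
    symm
    rw [eq_extend_iff]
    constructor
    · funext j
      rw [Function.comp_apply, oneWire_apply, Function.update_self]
      rfl
    · intro a ha
      exact Function.update_of_ne (ha 0).symm _ _
  rw [h, h]
  have e : Function.update z b 0 = z := by rw [← hz, Function.update_eq_self]
  rw [e]
  simp [hadamardGate, hz, div_eq_mul_inv]

/-! ### Tests with an enabling flag and random choices between them -/

/-- The evolution of the observable `X` on `I` in the Heisenberg picture, when `Q` is applied to `I`
and ancillas in the state `|z⟩`. -/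
def heisenberg (Q : WireOp (I ⊕ A)) (z : I ⊕ A → Fin 2) (X : WireOp I) : WireOp I :=
  (Q * inc (inputs I A) z).conjTranspose * lift (inputs I A) X * (Q * inc (inputs I A) z)

variable (G) in
/-- A test with effect `M` and output wire `o`, realized with `c` gates, with an enabling ancilla: if
that ancilla is `|0⟩` then the input is left unchanged. -/
def ControlledTest (o : I) (c : ℕ) (M : WireOp I) : Prop :=
  ∃ (A : Type) (_ : Fintype A) (_ : DecidableEq A) (e : A) (Q : WireOp (I ⊕ A)),
    ImplWithin G c Q ∧ (∀ X, heisenberg Q 0 X = X) ∧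
      heisenberg Q (Pi.single (Sum.inr e) 1) (measOp o) = M

variable {A' : Type} [Fintype A'] [DecidableEq A']

/-- The wires of the first test within those of a random choice between two tests. -/
def leftWires (I A A' : Type) : I ⊕ A ↪ I ⊕ (Unit ⊕ (A ⊕ A')) :=
  (Function.Embedding.refl I).sumMap (Function.Embedding.inl.trans Function.Embedding.inr)

/-- The wires of the second test within those of a random choice between two tests. -/
def rightWires (I A A' : Type) : I ⊕ A' ↪ I ⊕ (Unit ⊕ (A ⊕ A')) :=
  (Function.Embedding.refl I).sumMap (Function.Embedding.inr.trans Function.Embedding.inr)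

/-- `Q` acts on the state first, so the observable is pulled back through `Q'` first. The ancilla
registers are disjoint, hence this first pullback is again an observable on the inputs alone. -/
theorem heisenberg_seq (Q : WireOp (I ⊕ A)) (Q' : WireOp (I ⊕ A'))
    (z : I ⊕ (Unit ⊕ (A ⊕ A')) → Fin 2) (X : WireOp I) :
    heisenberg (lift (rightWires I A A') Q' * lift (leftWires I A A') Q) z X =
      heisenberg Q (z ∘ leftWires I A A') (heisenberg Q' (z ∘ rightWires I A A') X) := by
  have e : inputs I (Unit ⊕ (A ⊕ A')) = (inputs I A).trans (leftWires I A A') := rfl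
  have e' : inputs I (Unit ⊕ (A ⊕ A')) = (inputs I A').trans (rightWires I A A') := rfl
  have hsq : lift (inputs I A) (heisenberg Q' (z ∘ rightWires I A A') X) =
      (inc (leftWires I A A') z).conjTranspose * lift (rightWires I A A')
        (Q'.conjTranspose * lift (inputs I A') X * Q') * inc (leftWires I A A') z := by
    rw [inc_conj_lift_inc_of_square (j₁ := inputs I A) (j₂ := inputs I A')]
    · simp only [heisenberg, Matrix.conjTranspose_mul, Matrix.mul_assoc]
    · intro a; rfl
    · rintro (v | v) (w | w) h
      · exact ⟨v, rfl, congrArg Sum.inl (Sum.inl_injective h)⟩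
      all_goals simp [leftWires, rightWires] at h
  have hinc : lift (rightWires I A A') Q' * lift (leftWires I A A') Q *
      inc (inputs I (Unit ⊕ (A ⊕ A'))) z = lift (rightWires I A A') Q' *
        (inc (leftWires I A A') z * (Q * inc (inputs I A) (z ∘ leftWires I A A'))) := by
    rw [e, inc_trans, Matrix.mul_assoc, ← Matrix.mul_assoc (lift (leftWires I A A') Q),
      lift_mul_inc, Matrix.mul_assoc]
  rw [heisenberg, hinc, heisenberg, hsq, e', lift_trans]
  simp only [Matrix.conjTranspose_mul, Matrix.mul_assoc, lift_mul, lift_conjTranspose]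

theorem controlledSwap_update_zero {b f f' : W} (hf : b ≠ f) (hf' : b ≠ f') :
    controlledSwap b f f' (Function.update (0 : W → Fin 2) b 1) =
      Function.update (0 : W → Fin 2) b 1 := by
  rw [controlledSwap, if_pos (Function.update_self _ _ _)]
  funext x
  have : Equiv.swap f f' x = b ↔ x = b := by
    rw [Equiv.swap_apply_eq_iff, Equiv.swap_apply_of_ne_of_ne hf hf']
  simp [Function.update_apply, this]

theorem controlledSwap_update_single {b f f' : W} (hf : b ≠ f) (hf' : b ≠ f') :
    controlledSwap b f f' (Function.update (Pi.single f 1) b 1) =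
      Function.update (Pi.single f' 1) b 1 := by
  rw [controlledSwap, if_pos (Function.update_self _ _ _)]
  funext x
  have h : Equiv.swap f f' x = b ↔ x = b := by
    rw [Equiv.swap_apply_eq_iff, Equiv.swap_apply_of_ne_of_ne hf hf']
  have h' : Equiv.swap f f' x = f ↔ x = f' := by
    rw [Equiv.swap_apply_eq_iff, Equiv.swap_apply_left]
  simp [Function.update_apply, h, Pi.single_apply, h']

/-- By `hY'` and `hk` the pulled-back observable does not involve the coin `b`, so the branches with
coin 0 and coin 1 do not interfere, and each has weight 1/2. -/
theorem heisenberg_coin (Z : WireOp (I ⊕ A)) {b f f' : A} (hf : b ≠ f) (hf' : b ≠ f')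
    (k : V ↪ I ⊕ A) (hk : ∀ v, k v ≠ Sum.inr b) (Y : WireOp I) (Y' : WireOp V)
    (hY' : Z.conjTranspose * lift (inputs I A) Y * Z = lift k Y')
    (z : I ⊕ A → Fin 2) (hz : z (Sum.inr b) = 0) :
    heisenberg (Z * (basisMap (controlledSwap (Sum.inr b) (Sum.inr f) (Sum.inr f')) *
        hadamardOn (Sum.inr b))) z Y =
      (2 : ℂ)⁻¹ • (heisenberg Z z Y + heisenberg Z
        (controlledSwap (Sum.inr b) (Sum.inr f) (Sum.inr f') (Function.update z (Sum.inr b) 1)) Y) := by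
  have hi (a : A) : ∀ v, inputs I A v ≠ Sum.inr a := by intro v; simp
  have hcz : controlledSwap (Sum.inr b) (Sum.inr f) (Sum.inr f') z = z := by
    simp [controlledSwap, hz]
  set z' := controlledSwap (Sum.inr b) (Sum.inr f) (Sum.inr f') (Function.update z (Sum.inr b) 1)
    with hz'
  have hzb : z' (Sum.inr b) = 1 := by
    have hbf : Equiv.swap (Sum.inr f : I ⊕ A) (Sum.inr f') (Sum.inr b) = Sum.inr b :=
      Equiv.swap_apply_of_ne_of_ne (by simp [hf]) (by simp [hf'])
    simp [hz', controlledSwap, hbf]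
  have hcol : Z * (basisMap (controlledSwap (Sum.inr b) (Sum.inr f) (Sum.inr f')) *
      hadamardOn (Sum.inr b)) * inc (inputs I A) z = (((Real.sqrt 2 : ℝ) : ℂ)⁻¹) •
        (Z * inc (inputs I A) z + Z * inc (inputs I A) z') := by
    rw [Matrix.mul_assoc, Matrix.mul_assoc, hadamardOn_mul_inc _ _ (hi b) hz, Matrix.mul_smul,
      Matrix.mul_smul, Matrix.mul_add, Matrix.mul_add,
      controlledSwap_mul_inc _ _ (hi b) (hi f) (hi f'),
      controlledSwap_mul_inc _ _ (hi b) (hi f) (hi f'), hcz]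
  have cross {y y' : I ⊕ A → Fin 2} (hy : y (Sum.inr b) ≠ y' (Sum.inr b)) :
      (Z * inc (inputs I A) y).conjTranspose * lift (inputs I A) Y *
        (Z * inc (inputs I A) y') = 0 := by
    have := inc_conj_lift_inc_eq_zero _ k Y' (hi b) hk hy
    rw [← hY'] at this
    rw [← this]
    simp only [Matrix.conjTranspose_mul, Matrix.mul_assoc]
  have hs : star ((((Real.sqrt 2 : ℝ) : ℂ))⁻¹) * (((Real.sqrt 2 : ℝ) : ℂ))⁻¹ = (2 : ℂ)⁻¹ := by
    rw [star_inv₀, Complex.star_def, Complex.conj_ofReal, ← mul_inv, ← Complex.ofReal_mul,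
      Real.mul_self_sqrt (by norm_num)]
    norm_num
  have c1 := cross (y := z) (y' := z') (by rw [hz, hzb]; decide)
  have c2 := cross (y := z') (y' := z) (by rw [hz, hzb]; decide)
  rw [heisenberg, hcol, Matrix.conjTranspose_smul, Matrix.smul_mul, Matrix.smul_mul,
    Matrix.mul_smul, smul_smul, hs, Matrix.conjTranspose_add, Matrix.add_mul, Matrix.add_mul,
    Matrix.mul_add, Matrix.mul_add, c1, c2, add_zero, zero_add]
  rfl

/-- Both circuits always run. The flag of the combined test is the flag of the first one, and the
coin, if 1, hands it over to the second. A raised flag therefore enables exactly one test, and a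
lowered flag enables none, whatever the coin shows. -/
theorem ControlledTest.coin {o : I} {c c' cs ch : ℕ} {M M' : WireOp I}
    (hF : ImplWithin G cs (basisMap (controlledSwap 0 1 2) : WireOp (Fin 3)))
    (hH : ImplWithin G ch hadamardGate)
    (h : ControlledTest G o c M) (h' : ControlledTest G o c' M') :
    ControlledTest G o (c' + c + (cs + ch)) ((2 : ℂ)⁻¹ • (M + M')) := by
  obtain ⟨A, _, _, e, Q, h1, h2, h3⟩ := h
  obtain ⟨A', _, _, e', Q', h1', h2', h3'⟩ := h'
  let b : Unit ⊕ (A ⊕ A') := Sum.inl ()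
  let f : Unit ⊕ (A ⊕ A') := Sum.inr (Sum.inl e)
  let f' : Unit ⊕ (A ⊕ A') := Sum.inr (Sum.inr e')
  have hf : b ≠ f := by simp [b, f]
  have hf' : b ≠ f' := by simp [b, f']
  have key := fun Y => heisenberg_coin
    (lift (rightWires I A A') Q' * lift (leftWires I A A') Q) hf hf'
    ((Function.Embedding.refl I).sumMap Function.Embedding.inr)
    (by rintro (w | w) <;> simp [b]) Y
    ((lift ((Function.Embedding.refl I).sumMap Function.Embedding.inr) Q' *
        lift ((Function.Embedding.refl I).sumMap Function.Embedding.inl) Q).conjTranspose *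
      lift (inputs I (A ⊕ A')) Y * (lift ((Function.Embedding.refl I).sumMap
        Function.Embedding.inr) Q' *
          lift ((Function.Embedding.refl I).sumMap Function.Embedding.inl) Q)) (by
      have el : leftWires I A A' = ((Function.Embedding.refl I).sumMap
          Function.Embedding.inl).trans
            ((Function.Embedding.refl I).sumMap Function.Embedding.inr) := by ext (x | x) <;> rfl
      have er : rightWires I A A' = ((Function.Embedding.refl I).sumMap
          Function.Embedding.inr).trans
            ((Function.Embedding.refl I).sumMap Function.Embedding.inr) := by ext (x | x) <;> rfl
      have ei : inputs I (Unit ⊕ (A ⊕ A')) = (inputs I (A ⊕ A')).trans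
          ((Function.Embedding.refl I).sumMap Function.Embedding.inr) := rfl
      simp only [el, er, ei, lift_trans, lift_mul, lift_conjTranspose])
  refine ⟨Unit ⊕ (A ⊕ A'), inferInstance, inferInstance, f, _,
    ((h1'.lift_op (rightWires I A A')).mul (h1.lift_op (leftWires I A A'))).mul
      ((controlledSwap_implWithin hF (e := Sum.inr b) (a := Sum.inr f) (b := Sum.inr f')
        (by simp [hf]) (by simp [hf']) (by simp [f, f'])).mul
          (hH.lift_op (oneWire (Sum.inr b)))), fun Y => ?_, ?_⟩
  · rw [← hadamardOn, key Y 0 rfl, controlledSwap_update_zero (by simp [hf]) (by simp [hf']),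
      heisenberg_seq, heisenberg_seq]
    have e1 : Function.update (0 : I ⊕ (Unit ⊕ (A ⊕ A')) → Fin 2) (Sum.inr b) 1 ∘
        leftWires I A A' = 0 := by
      funext x; rcases x with x | x <;> simp [leftWires, b]
    have e2 : Function.update (0 : I ⊕ (Unit ⊕ (A ⊕ A')) → Fin 2) (Sum.inr b) 1 ∘
        rightWires I A A' = 0 := by
      funext x; rcases x with x | x <;> simp [rightWires, b]
    have e3 : (0 : I ⊕ (Unit ⊕ (A ⊕ A')) → Fin 2) ∘ leftWires I A A' = 0 := rfl
    have e4 : (0 : I ⊕ (Unit ⊕ (A ⊕ A')) → Fin 2) ∘ rightWires I A A' = 0 := rfl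
    rw [e1, e2, e3, e4, h2', h2, ← two_smul ℂ, smul_smul]
    norm_num
  · rw [← hadamardOn, key _ _ (by simp [b, f]),
      controlledSwap_update_single (by simp [hf]) (by simp [hf']), heisenberg_seq, heisenberg_seq]
    have e1 : Function.update (Pi.single (Sum.inr f') 1 : I ⊕ (Unit ⊕ (A ⊕ A')) → Fin 2)
        (Sum.inr b) 1 ∘ leftWires I A A' = 0 := by
      funext x; rcases x with x | x <;> simp [leftWires, b, f']
    have e2 : Function.update (Pi.single (Sum.inr f') 1 : I ⊕ (Unit ⊕ (A ⊕ A')) → Fin 2)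
        (Sum.inr b) 1 ∘ rightWires I A A' = Pi.single (Sum.inr e') 1 := by
      funext x; rcases x with x | x <;> simp [rightWires, b, f', Pi.single_apply]
    have e3 : (Pi.single (Sum.inr f) 1 : I ⊕ (Unit ⊕ (A ⊕ A')) → Fin 2) ∘ leftWires I A A' =
        Pi.single (Sum.inr e) 1 := by
      funext x; rcases x with x | x <;> simp [leftWires, f, Pi.single_apply]
    have e4 : (Pi.single (Sum.inr f) 1 : I ⊕ (Unit ⊕ (A ⊕ A')) → Fin 2) ∘ rightWires I A A' = 0 := by
      funext x; rcases x with x | x <;> simp [rightWires, f]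
    rw [e1, e2, e3, e4, h2', h3, h2, h3']

/-- The uniform average of `2 ^ r` controlled tests. -/
theorem ControlledTest.average {o : I} {c cs ch : ℕ}
    (hF : ImplWithin G cs (basisMap (controlledSwap 0 1 2) : WireOp (Fin 3)))
    (hH : ImplWithin G ch hadamardGate) (r : ℕ) (M : ℕ → WireOp I)
    (h : ∀ i < 2 ^ r, ControlledTest G o c (M i)) :
    ∃ k, k + (cs + ch) ≤ 2 ^ r * (c + (cs + ch)) ∧
      ControlledTest G o k (((2 : ℂ) ^ r)⁻¹ • ∑ i ∈ Finset.range (2 ^ r), M i) := by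
  induction r generalizing M with
  | zero => exact ⟨c, by simp, by simpa using h 0 (by simp)⟩
  | succ r ih =>
    obtain ⟨k, hk, h1⟩ := ih M fun i hi => h i (by rw [pow_succ]; omega)
    obtain ⟨k', hk', h2⟩ := ih (fun i => M (2 ^ r + i)) fun i hi => h _ (by rw [pow_succ]; omega)
    -- The slack `cs + ch` in the size bound pays for the new coin: a binary tree with `2 ^ r`
    -- leaves has `2 ^ r - 1` inner nodes.
    refine ⟨k' + k + (cs + ch), by rw [pow_succ]; linarith, ?_⟩
    convert ControlledTest.coin hF hH h1 h2 using 1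
    rw [show 2 ^ (r + 1) = 2 ^ r + 2 ^ r by omega, Finset.sum_range_add, ← smul_add, smul_smul, pow_succ, mul_inv,
      mul_comm]

/-! ### Enabling a circuit by exchanging inputs with dummies -/

/-- `U` acts trivially off the wires of `S`. -/
def SupportedOn (S : Finset W) (U : WireOp W) : Prop :=
  ∀ {X : Type} [Fintype X] [DecidableEq X] (d r : W ↪ X), (∀ w ∈ S, d w = r w) → lift d U = lift r U

theorem SupportedOn.mono {S T : Finset W} {U : WireOp W} (h : SupportedOn S U) (hST : S ⊆ T) :
    SupportedOn T U :=
  fun d r hd => h d r fun w hw => hd w (hST hw)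

theorem supportedOn_one (S : Finset W) : SupportedOn S (1 : WireOp W) := fun d r _ => by simp

theorem SupportedOn.mul {S : Finset W} {U U' : WireOp W} (h : SupportedOn S U)
    (h' : SupportedOn S U') : SupportedOn S (U * U') :=
  fun d r hd => by rw [lift_mul, lift_mul, h d r hd, h' d r hd]

theorem supportedOn_lift (i : V ↪ W) (A : WireOp V) :
    SupportedOn (Finset.univ.map i) (lift i A) := by
  intro X _ _ d r hd
  rw [← lift_trans, ← lift_trans]
  congr 1
  ext v
  exact hd _ (by simp)

/-- Bounded arity makes the number of wires to be exchanged linear in the size of the circuit and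
independent of the number of inputs. Exchanging all inputs would cost a further factor of order n
for small circuits. -/
theorem wireCircuitOp_supportedOn {K : ℕ} (hK : ∀ g, G.arity g ≤ K) (L : List (WireGate G W)) :
    ∃ S : Finset W, S.card ≤ K * L.length ∧ SupportedOn S (wireCircuitOp L) := by
  induction L with
  | nil => exact ⟨∅, by simp, supportedOn_one _⟩
  | cons p L ih =>
    obtain ⟨S, h1, h2⟩ := ih
    refine ⟨Finset.univ.map p.wires ∪ S, ?_, ?_⟩
    · refine (Finset.card_union_le _ _).trans ?_
      have := hK p.gate
      rw [Finset.card_map, Finset.card_univ, Fintype.card_fin, List.length_cons, mul_add, mul_one]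
      omega
    · rw [wireCircuitOp_cons]
      exact SupportedOn.mul (SupportedOn.mono (supportedOn_lift _ _) Finset.subset_union_left)
        (SupportedOn.mono h2 Finset.subset_union_right)

/-- The wires of a controlled test: the input, the enabling ancilla, a dummy input, and the
ancillas of the test. -/
abbrev DummyWires (I A : Type) : Type := I ⊕ (Unit ⊕ (I ⊕ A))

/-- The exchange of the inputs in `T` with the corresponding dummy inputs. -/
def dummySwapFun (B : Type) (T : Finset I) : DummyWires I B → DummyWires I B
  | .inl i => if i ∈ T then .inr (.inr (.inl i)) else .inl i
  | .inr (.inr (.inl i)) => if i ∈ T then .inl i else .inr (.inr (.inl i))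
  | .inr (.inl u) => .inr (.inl u)
  | .inr (.inr (.inr a)) => .inr (.inr (.inr a))

theorem dummySwapFun_involutive {B : Type} (T : Finset I) :
    Function.Involutive (dummySwapFun B T) := by
  rintro (i | u | i | a) <;> simp only [dummySwapFun]
  all_goals split_ifs with h <;> simp [h]

/-- `dummySwapFun` as a permutation. -/
def dummySwap (B : Type) (T : Finset I) : Equiv.Perm (DummyWires I B) :=
  (dummySwapFun_involutive T).toPerm

theorem dummySwap_insert {B : Type} [DecidableEq B] {T : Finset I} {i : I} (hi : i ∉ T) :
    (dummySwap B (insert i T) : DummyWires I B → DummyWires I B) =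
      dummySwap B T ∘ Equiv.swap (.inl i) (.inr (.inr (.inl i))) := by
  funext w
  rcases w with j | u | j | a
  · by_cases h : j = i
    · subst h; simp [dummySwap, dummySwapFun, hi]
    · simp [dummySwap, dummySwapFun, Equiv.swap_apply_def, h]
  · simp [dummySwap, dummySwapFun, Equiv.swap_apply_def]
  · by_cases h : j = i
    · subst h; simp [dummySwap, dummySwapFun, hi]
    · simp [dummySwap, dummySwapFun, Equiv.swap_apply_def, h]
  · simp [dummySwap, dummySwapFun, Equiv.swap_apply_def]

/-- Application of a permutation of the wires, if the wire `e` is `|1⟩`. -/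
def controlledPerm (e : W) (σ : Equiv.Perm W) (x : W → Fin 2) : W → Fin 2 :=
  if x e = 1 then x ∘ σ else x

/-- One Fredkin gate per exchanged input, all controlled by the same flag, which none of them
alters. -/
theorem controlledPerm_dummySwap_implWithin {c : ℕ}
    (h : ImplWithin G c (basisMap (controlledSwap 0 1 2) : WireOp (Fin 3))) (T : Finset I) :
    ImplWithin G (T.card * c)
      (basisMap (controlledPerm (.inr (.inl ())) (dummySwap A T))) := by
  induction T using Finset.induction_on with
  | empty =>
    have : basisMap (controlledPerm (.inr (.inl ())) (dummySwap A (∅ : Finset I))) = 1 := by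
      have h1 : (dummySwap A (∅ : Finset I) : DummyWires I A → DummyWires I A) = id := by
        funext w; rcases w with j | u | j | a <;> simp [dummySwap, dummySwapFun]
      ext x y
      simp [basisMap, controlledPerm, h1, Matrix.one_apply]
    rw [this]
    simpa using ImplWithin.one
  | insert i T hi ih =>
    have : controlledPerm (.inr (.inl ())) (dummySwap A (insert i T)) =
        controlledSwap (.inr (.inl ())) (.inl i) (.inr (.inr (.inl i))) ∘
          controlledPerm (.inr (.inl ())) (dummySwap A T) := by
      funext x
      have hx : controlledPerm (.inr (.inl ())) (dummySwap A T) x (.inr (.inl ())) =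
          x (.inr (.inl ())) := by
        unfold controlledPerm
        split_ifs
        · rfl
        · rfl
      rw [Function.comp_apply, controlledSwap, hx]
      unfold controlledPerm
      split_ifs
      · rw [dummySwap_insert hi]; rfl
      · rfl
    rw [this, ← basisMap_mul, Finset.card_insert_of_notMem hi, add_mul, one_mul, add_comm]
    exact (controlledSwap_implWithin h (by simp) (by simp) (by simp)).mul ih

theorem measOp_comm_wirePerm {e : W} {σ : Equiv.Perm W} (hσ : σ e = e) :
    measOp e * basisMap (fun x => x ∘ σ) = basisMap (fun x => x ∘ σ) * measOp e := by
  ext x y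
  rw [measOp, Matrix.diagonal_mul, Matrix.mul_diagonal]
  by_cases h : x = y ∘ σ
  · simp [h, hσ, mul_comm]
  · simp [basisMap, h]

theorem basisMap_controlledPerm (e : W) (σ : Equiv.Perm W) :
    basisMap (controlledPerm e σ) = (1 - measOp e) + basisMap (fun x => x ∘ σ) * measOp e := by
  ext x y
  rw [Matrix.add_apply, Matrix.sub_apply, measOp, Matrix.mul_diagonal, Matrix.one_apply,
    Matrix.diagonal_apply]
  simp only [basisMap, Matrix.of_apply, controlledPerm]
  by_cases hy : y e = 1
  · by_cases hxy : x = y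
    · simp [hxy, hy]
    · simp [hxy, hy]
  · by_cases hxy : x = y
    · simp [hxy, hy]
    · simp [hxy, hy]

theorem controlledPerm_mul_of_zero {e : W} {σ : Equiv.Perm W} {α : Type}
    {M : Matrix (W → Fin 2) α ℂ} (hM : measOp e * M = 0) :
    basisMap (controlledPerm e σ) * M = M := by
  rw [basisMap_controlledPerm, Matrix.add_mul, Matrix.sub_mul, Matrix.mul_assoc, hM,
    Matrix.mul_zero, Matrix.one_mul, sub_zero, add_zero]

theorem controlledPerm_mul_of_one {e : W} {σ : Equiv.Perm W} {α : Type}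
    {M : Matrix (W → Fin 2) α ℂ} (hM : measOp e * M = M) :
    basisMap (controlledPerm e σ) * M = basisMap (fun x => x ∘ σ) * M := by
  rw [basisMap_controlledPerm, Matrix.add_mul, Matrix.sub_mul, Matrix.mul_assoc, hM,
    Matrix.one_mul, sub_self, zero_add]

/-- The circuit is `U` on the dummies, with a controlled exchange before and after it. If the flag
is 0, `U` spends itself on the dummies. If it is 1, the exchanges reroute `U` to the real inputs. -/
theorem controlledTest_of_supportedOn {o : I} {c cs : ℕ}
    (hF : ImplWithin G cs (basisMap (controlledSwap 0 1 2) : WireOp (Fin 3)))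
    {U : WireOp (I ⊕ A)} (hU : U.conjTranspose * U = 1) (hc : ImplWithin G c U)
    {S : Finset (I ⊕ A)} (hS : SupportedOn S U) :
    ControlledTest G o (S.card * cs + c + S.card * cs) (heisenberg U 0 (measOp o)) := by
  let d : I ⊕ A ↪ DummyWires I A := Function.Embedding.inr.trans Function.Embedding.inr
  let r : I ⊕ A ↪ DummyWires I A :=
    (Function.Embedding.refl I).sumMap (Function.Embedding.inr.trans Function.Embedding.inr)
  let e : Unit ⊕ (I ⊕ A) := .inl ()
  let T := S.toLeft
  let σ := dummySwap A T
  have hT : T.card ≤ S.card := Finset.card_toLeft_le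
  have hσe : σ (.inr e) = .inr e := rfl
  let P := basisMap (controlledPerm (.inr e) σ)
  have hP : ImplWithin G (S.card * cs) P :=
    (controlledPerm_dummySwap_implWithin hF T).mono (Nat.mul_le_mul_right _ hT)
  let w : WireOp (DummyWires I A) := basisMap fun x => x ∘ σ
  -- After rerouting, the placement agrees with `r` only on the support `S`, which is all that `hS`
  -- needs.
  have hw : w * lift d U * w = lift r U := by
    rw [wirePerm_conj_lift σ (dummySwapFun_involutive T) d (d.trans σ.toEmbedding) (fun _ => rfl)]
    apply hS
    rintro (i | a) hi
    · have : i ∈ T := by simpa [T] using hi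
      simp [d, r, σ, dummySwap, dummySwapFun, this]
    · simp [d, r, σ, dummySwap, dummySwapFun]
  have hd : ∀ v, d v ≠ .inr e := by intro v; simp [d, e]
  have hi : ∀ v, inputs I (Unit ⊕ (I ⊕ A)) v ≠ .inr e := by intro v; simp
  refine ⟨Unit ⊕ (I ⊕ A), inferInstance, inferInstance, e, P * lift d U * P,
    (hP.mul (hc.lift_op d)).mul hP, fun X => ?_, ?_⟩
  · have h0 : measOp (.inr e : I ⊕ (Unit ⊕ (I ⊕ A))) * inc (inputs I (Unit ⊕ (I ⊕ A))) 0 = 0 := by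
      rw [measOp_mul_inc _ _ hi]; simp
    have h1 : P * lift d U * P * inc (inputs I (Unit ⊕ (I ⊕ A))) 0 =
        lift d U * inc (inputs I (Unit ⊕ (I ⊕ A))) 0 := by
      rw [Matrix.mul_assoc, controlledPerm_mul_of_zero h0, Matrix.mul_assoc,
        controlledPerm_mul_of_zero]
      rw [← Matrix.mul_assoc, measOp_comm_lift d U hd, Matrix.mul_assoc, h0, Matrix.mul_zero]
    rw [heisenberg, h1, Matrix.conjTranspose_mul]
    -- Acting on disjoint wires, `U` commutes with the observable and cancels against its adjoint.
    have h2 : lift (inputs I (Unit ⊕ (I ⊕ A))) X * lift d U =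
        lift d U * lift (inputs I (Unit ⊕ (I ⊕ A))) X :=
      lift_comm _ _ (fun v w => by simp [d]) _ _
    rw [Matrix.mul_assoc, Matrix.mul_assoc, ← Matrix.mul_assoc _ (lift d U), h2,
      Matrix.mul_assoc (lift d U), ← Matrix.mul_assoc _ (lift d U), lift_unitary d hU,
      Matrix.one_mul, lift_mul_inc, ← Matrix.mul_assoc, inc_conj_mul_inc, Matrix.one_mul]
  · set z : I ⊕ (Unit ⊕ (I ⊕ A)) → Fin 2 := Pi.single (.inr e) 1 with hz
    have h0 : measOp (.inr e : I ⊕ (Unit ⊕ (I ⊕ A))) * inc (inputs I (Unit ⊕ (I ⊕ A))) z =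
        inc (inputs I (Unit ⊕ (I ⊕ A))) z := by
      rw [measOp_mul_inc _ _ hi]; simp [hz]
    have h1 : P * lift d U * P * inc (inputs I (Unit ⊕ (I ⊕ A))) z =
        lift r U * inc (inputs I (Unit ⊕ (I ⊕ A))) z := by
      rw [Matrix.mul_assoc, controlledPerm_mul_of_one h0, Matrix.mul_assoc,
        controlledPerm_mul_of_one]
      · rw [← hw]; simp only [Matrix.mul_assoc, w]
      · rw [← Matrix.mul_assoc, measOp_comm_lift d U hd, Matrix.mul_assoc,
          ← Matrix.mul_assoc (measOp _), measOp_comm_wirePerm hσe, Matrix.mul_assoc _ (measOp _), h0]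
    have hr : inputs I (Unit ⊕ (I ⊕ A)) = (inputs I A).trans r := rfl
    have hzr : z ∘ r = 0 := by
      funext x; rcases x with x | x <;> simp [r, hz, e]
    have h3 : lift r U * inc (inputs I (Unit ⊕ (I ⊕ A))) z =
        inc r z * (U * inc (inputs I A) 0) := by
      rw [hr, inc_trans, ← Matrix.mul_assoc, lift_mul_inc, Matrix.mul_assoc, hzr]
    have h4 : lift (inputs I (Unit ⊕ (I ⊕ A))) (measOp o) =
        lift r (lift (inputs I A) (measOp o)) := by
      rw [hr, lift_trans]
    rw [heisenberg, h1, h3, h4, Matrix.mul_assoc, ← Matrix.mul_assoc (lift r _), lift_mul_inc,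
      Matrix.conjTranspose_mul, Matrix.mul_assoc, Matrix.mul_assoc (inc r z),
      ← Matrix.mul_assoc _ (inc r z), inc_conj_mul_inc, Matrix.one_mul, heisenberg,
      Matrix.mul_assoc]

end Controlled

/-! ### Effects of distinguishers and their conversion to and from controlled tests -/

section Effects

variable {G : GateSet} {n : ℕ}

theorem measOp_posSemidef {W : Type} [Fintype W] [DecidableEq W] (w : W) :
    (measOp w).PosSemidef := by
  rw [measOp, Matrix.posSemidef_diagonal_iff]
  intro x; split_ifs <;> simp

theorem one_sub_measOp_posSemidef {W : Type} [Fintype W] [DecidableEq W] (w : W) :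
    (1 - measOp w).PosSemidef := by
  have : 1 - measOp w = Matrix.diagonal fun x : W → Fin 2 => if x w = 1 then 0 else 1 := by
    rw [measOp, ← Matrix.diagonal_one, Matrix.diagonal_sub]
    congr 1; funext x; split_ifs <;> simp
  rw [this, Matrix.posSemidef_diagonal_iff]
  intro x; split_ifs <;> simp

/-- The first `n` of `n + a` qubits. -/
abbrev firstQubits (n a : ℕ) : Fin n ↪ Fin (n + a) := Fin.castAddEmb a

namespace Distinguisher

/-- The measured qubit. -/
def firstQubit (A : Distinguisher G n) : Fin (n + A.anc) := ⟨0, A.pos⟩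

/-- The isometry from the input space to the final state of the circuit. -/
def isometry (A : Distinguisher G n) : Matrix (Qubits (n + A.anc)) (Qubits n) ℂ :=
  circuitOp A.gates * inc (firstQubits n A.anc) 0

/-- The effect of the outcome `1`. -/
def effect (A : Distinguisher G n) : QOp n :=
  A.isometry.conjTranspose * measOp A.firstQubit * A.isometry

theorem withAncilla_eq (a : ℕ) (ρ : QOp n) :
    withAncilla a ρ = inc (firstQubits n a) 0 * ρ * (inc (firstQubits n a) 0).conjTranspose := by
  have hoff (x : Qubits (n + a)) : (∀ w, (∀ b, Fin.castAddEmb a b ≠ w) → x w = (0 : Qubits (n + a)) w)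
      ↔ ∀ i : Fin a, x (Fin.natAdd n i) = 0 := by
    constructor
    · intro h i
      refine h _ fun b hb => ?_
      have := congrArg Fin.val hb
      simp at this
      omega
    · intro h w hw
      refine Fin.addCases (fun i hi => absurd rfl (hi i)) (fun i _ => h i) w hw
  ext x y
  have h2 : (inc (firstQubits n a) 0 * ρ * (inc (firstQubits n a) 0).conjTranspose) x y =
      star ((inc (firstQubits n a) 0 * (inc (firstQubits n a) 0 * ρ).conjTranspose) y x) := by
    rw [← Matrix.conjTranspose_apply, Matrix.conjTranspose_mul, Matrix.conjTranspose_conjTranspose]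
  rw [h2, inc_mul_apply, Matrix.conjTranspose_apply, inc_mul_apply, withAncilla, Matrix.of_apply]
  simp only [hoff, forall_and]
  by_cases h1 : ∀ i : Fin a, x (Fin.natAdd n i) = 0 <;>
    by_cases h2 : ∀ i : Fin a, y (Fin.natAdd n i) = 0 <;> simp [h1, h2]

theorem expect_eq (A : Distinguisher G n) (ρ : QOp n) :
    A.expect ρ = (A.effect * ρ).trace.re := by
  have h : A.proj = measOp A.firstQubit := rfl
  have h2 : A.proj * (circuitOp A.gates * withAncilla A.anc ρ * (circuitOp A.gates).conjTranspose)
      = measOp A.firstQubit * A.isometry * ρ * A.isometry.conjTranspose := by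
    rw [h, withAncilla_eq, isometry, Matrix.conjTranspose_mul]
    simp only [Matrix.mul_assoc]
  rw [expect, h2, Matrix.trace_mul_comm, effect]
  simp only [Matrix.mul_assoc]

theorem isometry_conj_mul (A : Distinguisher G n) : A.isometry.conjTranspose * A.isometry = 1 := by
  rw [isometry, Matrix.conjTranspose_mul, ← wireCircuitOp_toWireGate, Matrix.mul_assoc,
    ← Matrix.mul_assoc _ (wireCircuitOp _), wireCircuitOp_unitary, Matrix.one_mul, inc_conj_mul_inc]

theorem effect_posSemidef (A : Distinguisher G n) : A.effect.PosSemidef :=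
  (measOp_posSemidef _).conjTranspose_mul_mul_same _

theorem one_sub_effect_posSemidef (A : Distinguisher G n) : (1 - A.effect).PosSemidef := by
  have h := (one_sub_measOp_posSemidef A.firstQubit).conjTranspose_mul_mul_same
    A.isometry
  rwa [Matrix.mul_sub, Matrix.sub_mul, Matrix.mul_one, isometry_conj_mul] at h

/-- The circuit of a distinguisher, on wires split into inputs and ancillas. -/
def splitGates (A : Distinguisher G n) : List (WireGate G (Fin n ⊕ Fin A.anc)) :=
  (A.gates.map PlacedGate.toWireGate).map (.map finSumFinEquiv.symm.toEmbedding)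

/-- For `0 < n` the measured qubit is an input qubit, so all tests can share it as output wire. -/
theorem effect_eq_heisenberg (A : Distinguisher G n) (hn : 0 < n) :
    A.effect = heisenberg (wireCircuitOp A.splitGates) 0 (measOp ⟨0, hn⟩) := by
  let t : Fin n ⊕ Fin A.anc ↪ Fin (n + A.anc) := finSumFinEquiv.toEmbedding
  have ht : lift t (wireCircuitOp A.splitGates) = circuitOp A.gates := by
    rw [splitGates, wireCircuitOp_map, ← lift_trans, wireCircuitOp_toWireGate]
    have : (finSumFinEquiv.symm.toEmbedding : Fin (n + A.anc) ↪ Fin n ⊕ Fin A.anc).trans t =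
        Function.Embedding.refl _ := by ext x; simp [t]
    rw [this]
    ext x y
    rw [lift_apply, if_pos (fun a ha => absurd rfl (ha a))]
    rfl
  have hi : firstQubits n A.anc = (inputs (Fin n) (Fin A.anc)).trans t := by
    ext x; simp [t]
  have hV : A.isometry = inc t 0 * (wireCircuitOp A.splitGates * inc (inputs (Fin n) (Fin A.anc)) 0) := by
    rw [isometry, hi, inc_trans, ← ht, ← Matrix.mul_assoc, lift_mul_inc, Matrix.mul_assoc]
    rfl
  have hm : measOp A.firstQubit = lift t (lift (inputs (Fin n) (Fin A.anc)) (measOp ⟨0, hn⟩)) := by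
    rw [lift_measOp, lift_measOp]
    congr 1
  rw [effect, hV, hm, Matrix.mul_assoc, ← Matrix.mul_assoc (lift t _), lift_mul_inc,
      Matrix.conjTranspose_mul, Matrix.mul_assoc, Matrix.mul_assoc (inc t 0),
      ← Matrix.mul_assoc _ (inc t 0), inc_conj_mul_inc, Matrix.one_mul, heisenberg,
      Matrix.mul_assoc]

end Distinguisher

/-- The NOT gate on the wire `b`. -/
def notOn {W : Type} [Fintype W] [DecidableEq W] (b : W) : WireOp W := lift (oneWire b) notGate

section Not

variable {W V : Type} [Fintype W] [DecidableEq W] [Fintype V] [DecidableEq V]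

theorem notOn_eq (b : W) : notOn b = basisMap fun x => Function.update x b (x b + 1) := by
  have h : notGate = basisMap fun x : Qubits 1 => fun j => x j + 1 := by
    ext x y
    have : x = (fun j => y j + 1) ↔ ¬ x 0 = y 0 := by
      revert x y; decide
    simp only [notGate, basisMap, Matrix.of_apply, this]
    split_ifs <;> simp_all
  rw [notOn, h, lift_basisMap]
  congr 1
  funext y
  symm
  rw [eq_extend_iff]
  refine ⟨?_, fun a ha => Function.update_of_ne (ha 0).symm _ _⟩
  funext j
  simp

theorem notOn_mul_self (b : W) : notOn b * notOn b = 1 := by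
  rw [notOn_eq, basisMap_mul]
  ext x y
  have h : ∀ c : Fin 2, c + 1 + 1 = c := by decide
  simp [basisMap, Matrix.one_apply, h]

theorem notOn_conjTranspose (b : W) : (notOn b).conjTranspose = notOn b := by
  rw [notOn, ← lift_conjTranspose]
  congr 1
  ext x y
  simp [notGate, apply_ite, eq_comm]

theorem notOn_mul_inc (i : V ↪ W) (z : W → Fin 2) {b : W} (hb : ∀ v, i v ≠ b) :
    notOn b * inc i z = inc i (Function.update z b (z b + 1)) := by
  rw [notOn_eq]
  ext x v
  rw [mul_inc_apply]
  simp only [inc, basisMap, Matrix.of_apply]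
  have : Function.update (Function.extend i v z) b (Function.extend i v z b + 1) =
      Function.extend i v (Function.update z b (z b + 1)) := by
    rw [eq_extend_iff]
    constructor
    · funext u
      rw [Function.comp_apply, Function.update_of_ne (hb u), i.injective.extend_apply]
    · intro a ha
      rw [extend_off i v z hb, Function.update_apply, Function.update_apply, extend_off i v z ha]
  simp only [this]

theorem notOn_measOp (b : W) : notOn b * measOp b * notOn b = 1 - measOp b := by
  rw [notOn_eq]
  ext x y
  rw [mul_basisMap_apply, measOp, Matrix.mul_diagonal, Matrix.sub_apply, Matrix.one_apply,
    Matrix.diagonal_apply]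
  have h : ∀ c : Fin 2, c + 1 + 1 = c := by decide
  have h' : ∀ c : Fin 2, c + 1 = 1 ↔ ¬ c = 1 := by decide
  by_cases hxy : x = y
  · subst hxy
    simp only [basisMap, Matrix.of_apply]
    simp only [Function.update_idem, Function.update_self, h, Function.update_eq_self, h', if_true]
    split_ifs <;> simp_all
  · simp only [basisMap, Matrix.of_apply, Function.update_idem, Function.update_self, h,
      Function.update_eq_self, hxy]
    simp

end Not

theorem ControlledTest.mono {I : Type} [Fintype I] [DecidableEq I] {o : I} {c c' : ℕ} {M : WireOp I}
    (h : ControlledTest G o c M) (hc : c ≤ c') : ControlledTest G o c' M := by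
  obtain ⟨A, _, _, e, Q, h1, h2⟩ := h
  exact ⟨A, _, _, e, Q, h1.mono hc, h2⟩

theorem Distinguisher.controlledTest {cs K : ℕ}
    (hF : ImplWithin G cs (basisMap (controlledSwap 0 1 2) : WireOp (Fin 3)))
    (hK : ∀ g, G.arity g ≤ K) (A : Distinguisher G n) (hn : 0 < n) :
    ControlledTest G ⟨0, hn⟩ (2 * (K * A.size * cs) + A.size) A.effect := by
  obtain ⟨S, h1, h2⟩ := wireCircuitOp_supportedOn hK A.splitGates
  have hl : A.splitGates.length = A.size := by simp [Distinguisher.splitGates, Distinguisher.size]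
  rw [A.effect_eq_heisenberg hn]
  refine ControlledTest.mono (controlledTest_of_supportedOn hF (wireCircuitOp_unitary _)
    (wireCircuitOp_implWithin _) h2) ?_
  have := Nat.mul_le_mul_right cs h1
  rw [hl] at this ⊢
  omega

/-- A final NOT on the output wire exchanges the outcomes; it enlarges the support by at most one
wire. -/
theorem Distinguisher.controlledTest_compl {cs cn K : ℕ}
    (hF : ImplWithin G cs (basisMap (controlledSwap 0 1 2) : WireOp (Fin 3)))
    (hN : ImplWithin G cn notGate)
    (hK : ∀ g, G.arity g ≤ K) (A : Distinguisher G n) (hn : 0 < n) :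
    ControlledTest G ⟨0, hn⟩ (2 * ((K * A.size + 1) * cs) + A.size + cn) (1 - A.effect) := by
  obtain ⟨S, h1, h2⟩ := wireCircuitOp_supportedOn hK A.splitGates
  have hl : A.splitGates.length = A.size := by simp [Distinguisher.splitGates, Distinguisher.size]
  set U := wireCircuitOp A.splitGates with hUdef
  have hU : U.conjTranspose * U = 1 := wireCircuitOp_unitary _
  let o : Fin n ⊕ Fin A.anc := inputs _ _ ⟨0, hn⟩
  have hnot : (notOn o).conjTranspose * notOn o = 1 := by
    rw [notOn_conjTranspose, notOn_mul_self]
  have hsupp : SupportedOn (Finset.univ.map (oneWire o) ∪ S) (notOn o * U) :=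
    SupportedOn.mul (SupportedOn.mono (supportedOn_lift _ _) Finset.subset_union_left)
      (SupportedOn.mono h2 Finset.subset_union_right)
  have heff : heisenberg (notOn o * U) 0 (measOp ⟨0, hn⟩) = 1 - A.effect := by
    have hV : (U * inc (inputs (Fin n) (Fin A.anc)) 0).conjTranspose * (U * inc (inputs (Fin n) (Fin A.anc)) 0) = 1 := by
      rw [Matrix.conjTranspose_mul, Matrix.mul_assoc, ← Matrix.mul_assoc _ U, hU, Matrix.one_mul,
        inc_conj_mul_inc]
    rw [A.effect_eq_heisenberg hn, heisenberg, heisenberg, ← hUdef, lift_measOp, ← hV]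
    rw [Matrix.mul_assoc (notOn o), Matrix.conjTranspose_mul, notOn_conjTranspose]
    have : (U * inc (inputs (Fin n) (Fin A.anc)) 0).conjTranspose * notOn o * measOp o *
        (notOn o * (U * inc (inputs (Fin n) (Fin A.anc)) 0)) = (U * inc (inputs (Fin n) (Fin A.anc)) 0).conjTranspose *
          (notOn o * measOp o * notOn o) * (U * inc (inputs (Fin n) (Fin A.anc)) 0) := by
      simp only [Matrix.mul_assoc]
    rw [this, notOn_measOp, Matrix.mul_sub, Matrix.sub_mul, Matrix.mul_one]
  rw [← heff]
  refine ControlledTest.mono (controlledTest_of_supportedOn hF ?_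
    ((hN.lift_op (oneWire o)).mul (wireCircuitOp_implWithin _)) hsupp) ?_
  · rw [Matrix.conjTranspose_mul, Matrix.mul_assoc, ← Matrix.mul_assoc _ (lift _ _), ← notOn, hnot,
      Matrix.one_mul, hU]
  · have h3 : (Finset.univ.map (oneWire o) ∪ S).card ≤ K * A.size + 1 := by
      refine (Finset.card_union_le _ _).trans ?_
      rw [Finset.card_map, Finset.card_univ, Fintype.card_fin]
      rw [hl] at h1
      omega
    have := Nat.mul_le_mul_right cs h3
    rw [hl]
    omega

/-- Ancillas start in `|0⟩`, so an initial NOT raises the flag. The global phase cancels in the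
effect. -/
theorem ControlledTest.exists_distinguisher {c cn : ℕ} {hn : 0 < n} {M : QOp n}
    (hN : ImplWithin G cn notGate) (h : ControlledTest G (⟨0, hn⟩ : Fin n) c M) :
    ∃ A : Distinguisher G n, A.size ≤ c + cn ∧ A.effect = M := by
  obtain ⟨A, _, _, e, Q, h1, -, h3⟩ := h
  obtain ⟨B, _, _, L, φ, hL, hφ, hLQ⟩ := h1.mul (hN.lift_op (oneWire (Sum.inr e : Fin n ⊕ A)))
  let a := Fintype.card (A ⊕ B)
  let t : (Fin n ⊕ A) ⊕ B ↪ Fin (n + a) :=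
    ((Equiv.sumAssoc _ _ _).trans (((Equiv.refl (Fin n)).sumCongr (Fintype.equivFin (A ⊕ B))).trans
      finSumFinEquiv)).toEmbedding
  have hi : firstQubits n a = ((inputs (Fin n) A).trans (inputs _ B)).trans t := by
    ext x; simp [t]
  let D : Distinguisher G n := ⟨a, by omega, (L.map (.map t)).map WireGate.toPlacedGate⟩
  refine ⟨D, by simpa [D, Distinguisher.size] using hL, ?_⟩
  have hV : D.isometry =
      inc t 0 * (inc (inputs (Fin n ⊕ A) B) 0 * (φ • (Q * inc (inputs (Fin n) A) (Pi.single (Sum.inr e) 1)))) := by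
    have h4 : notOn (Sum.inr e : Fin n ⊕ A) * inc (inputs (Fin n) A) 0 =
        inc (inputs (Fin n) A) (Pi.single (Sum.inr e) 1) := by
      rw [notOn_mul_inc _ _ (by simp)]
      rfl
    change circuitOp ((L.map (.map t)).map WireGate.toPlacedGate) * inc (firstQubits n a) 0 = _
    rw [circuitOp_toPlacedGate, wireCircuitOp_map, hi, inc_trans, inc_trans, ← Matrix.mul_assoc,
      lift_mul_inc, Matrix.mul_assoc, ← Matrix.mul_assoc (wireCircuitOp L)]
    rw [show (0 : Fin (n + a) → Fin 2) ∘ t = 0 from rfl, hLQ,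
      show (0 : (Fin n ⊕ A) ⊕ B → Fin 2) ∘ inputs _ B = 0 from rfl, Matrix.mul_assoc, Matrix.smul_mul,
      Matrix.mul_assoc Q, ← notOn, h4]
  have hm : measOp D.firstQubit =
      lift t (lift (inputs _ B) (lift (inputs (Fin n) A) (measOp ⟨0, hn⟩))) := by
    rw [lift_measOp, lift_measOp, lift_measOp]
    congr 1
  have hc : star φ * φ = 1 := by
    rw [Complex.star_def, mul_comm, Complex.mul_conj, Complex.normSq_eq_norm_sq, hφ]
    simp
  rw [Distinguisher.effect, hV, hm, Matrix.mul_assoc, ← Matrix.mul_assoc (lift t _), lift_mul_inc,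
    Matrix.conjTranspose_mul, Matrix.mul_assoc, Matrix.mul_assoc (inc t 0),
    ← Matrix.mul_assoc _ (inc t 0), inc_conj_mul_inc, Matrix.one_mul,
    ← Matrix.mul_assoc (lift (inputs _ B) _), lift_mul_inc, Matrix.conjTranspose_mul,
    Matrix.mul_assoc, Matrix.mul_assoc (inc _ 0),
    ← Matrix.mul_assoc _ (inc _ 0), inc_conj_mul_inc, Matrix.one_mul,
    Matrix.conjTranspose_smul, Matrix.mul_smul, Matrix.mul_smul, Matrix.smul_mul, smul_smul,
    mul_comm φ, hc, one_smul, ← Matrix.mul_assoc]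
  exact h3

end Effects

/-! ### The trace exponential and sparse averages of effects -/

/-- The remainder is weighted by the exponentials at the two endpoints rather than at an
intermediate point. Every term is then a sum of products of a function of `a` and a function of `b`,
which is what survives the passage to noncommuting operators. -/
theorem exp_le_taylor_symm (a b : ℝ) :
    Real.exp b ≤ Real.exp a + Real.exp a * (b - a) +
      (Real.exp a + Real.exp b) * (b - a) ^ 2 / 2 := by
  -- This is the claim divided by `Real.exp a`, with `x = b - a`.
  have key (x : ℝ) : Real.exp x * (1 - x ^ 2 / 2) ≤ 1 + x + x ^ 2 / 2 := by
    have h0 : 0 < 1 + x + x ^ 2 / 2 := by nlinarith [sq_nonneg (x + 1)]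
    rcases le_or_gt (1 - x ^ 2 / 2) 0 with h | h
    · exact (mul_nonpos_of_nonneg_of_nonpos (Real.exp_pos x).le h).trans h0.le
    · rcases le_total 0 x with hx | hx
      · have hx2 : x < 2 := by nlinarith
        have h1 : 1 - x / 2 ≤ Real.exp (-(x / 2)) := by linarith [Real.add_one_le_exp (-(x / 2))]
        have h2 : (1 - x / 2) ^ 2 * Real.exp x ≤ 1 := by
          have : Real.exp (-(x / 2)) ^ 2 * Real.exp x = 1 := by
            rw [← Real.exp_nat_mul, ← Real.exp_add, ← Real.exp_zero]
            congr 1; push_cast; ring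
          refine le_trans ?_ this.le
          exact mul_le_mul_of_nonneg_right (pow_le_pow_left₀ (by linarith) h1 2) (Real.exp_pos x).le
        have h3 : 1 - x ^ 2 / 2 ≤ (1 - x / 2) ^ 2 * (1 + x + x ^ 2 / 2) := by
          nlinarith [mul_nonneg (sq_nonneg x) (add_nonneg (sq_nonneg (x - 1)) zero_le_one)]
        calc Real.exp x * (1 - x ^ 2 / 2)
            ≤ Real.exp x * ((1 - x / 2) ^ 2 * (1 + x + x ^ 2 / 2)) := by gcongr
          _ = ((1 - x / 2) ^ 2 * Real.exp x) * (1 + x + x ^ 2 / 2) := by ring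
          _ ≤ 1 * (1 + x + x ^ 2 / 2) := by gcongr
          _ = _ := one_mul _
      · have h1 := Real.quadratic_le_exp_of_nonneg (neg_nonneg.2 hx)
        have h2 : Real.exp x * (1 - x + x ^ 2 / 2) ≤ 1 := by
          have : Real.exp x * Real.exp (-x) = 1 := by rw [← Real.exp_add]; simp
          rw [← this]
          gcongr
          nlinarith
        have h3 : 1 - x ^ 2 / 2 ≤ (1 - x + x ^ 2 / 2) * (1 + x + x ^ 2 / 2) := by
          nlinarith [sq_nonneg x, sq_nonneg (x ^ 2)]
        calc Real.exp x * (1 - x ^ 2 / 2)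
            ≤ Real.exp x * ((1 - x + x ^ 2 / 2) * (1 + x + x ^ 2 / 2)) := by gcongr
          _ = (Real.exp x * (1 - x + x ^ 2 / 2)) * (1 + x + x ^ 2 / 2) := by ring
          _ ≤ 1 * (1 + x + x ^ 2 / 2) := by gcongr
          _ = _ := one_mul _
  have h := mul_le_mul_of_nonneg_left (key (b - a)) (Real.exp_pos a).le
  have e : Real.exp a * Real.exp (b - a) = Real.exp b := by rw [← Real.exp_add]; congr 1; ring
  rw [← mul_assoc, e] at h
  nlinarith

section Spectral

variable {m : Type} [Fintype m] [DecidableEq m]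

/-- The operator with orthonormal eigenvectors the columns of `U` and eigenvalues `d`. -/
def ofSpectrum (U : Matrix m m ℂ) (d : m → ℝ) : Matrix m m ℂ :=
  U * Matrix.diagonal (fun i => (d i : ℂ)) * U.conjTranspose

theorem ofSpectrum_mul {U : Matrix m m ℂ} (hU : U.conjTranspose * U = 1) (d d' : m → ℝ) :
    ofSpectrum U d * ofSpectrum U d' = ofSpectrum U (fun i => d i * d' i) := by
  have : ofSpectrum U d * ofSpectrum U d' = U * (Matrix.diagonal (fun i => (d i : ℂ)) *
      (U.conjTranspose * U) * Matrix.diagonal (fun i => (d' i : ℂ))) * U.conjTranspose := by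
    simp only [ofSpectrum, Matrix.mul_assoc]
  rw [this, hU, Matrix.mul_one, Matrix.diagonal_mul_diagonal, ofSpectrum]
  simp

theorem ofSpectrum_one {U : Matrix m m ℂ} (hU : U.conjTranspose * U = 1) :
    ofSpectrum U (fun _ => 1) = 1 := by
  simp [ofSpectrum, mul_eq_one_comm.1 hU]

theorem ofSpectrum_posSemidef (U : Matrix m m ℂ) {d : m → ℝ} (hd : ∀ i, 0 ≤ d i) :
    (ofSpectrum U d).PosSemidef :=
  (Matrix.posSemidef_diagonal_iff.2 fun i => by exact_mod_cast hd i).mul_mul_conjTranspose_same U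

/-- The squared overlaps of the two eigenbases are nonnegative weights, so scalar inequalities
between pairs of eigenvalues can be summed into trace inequalities. -/
theorem trace_ofSpectrum_mul_ofSpectrum (U V : Matrix m m ℂ) (d d' : m → ℝ) :
    (ofSpectrum U d * ofSpectrum V d').trace.re =
      ∑ i, ∑ j, d i * d' j * Complex.normSq ((U.conjTranspose * V) i j) := by
  have : (ofSpectrum U d * ofSpectrum V d').trace = (Matrix.diagonal (fun i => (d i : ℂ)) *
      (U.conjTranspose * V) * Matrix.diagonal (fun i => (d' i : ℂ)) *
        (U.conjTranspose * V).conjTranspose).trace := by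
    rw [ofSpectrum, Matrix.mul_assoc, Matrix.mul_assoc, Matrix.trace_mul_comm]
    simp only [ofSpectrum, Matrix.conjTranspose_mul, Matrix.conjTranspose_conjTranspose,
      Matrix.mul_assoc]
  rw [this, Matrix.trace, Complex.re_sum]
  refine Finset.sum_congr rfl fun i _ => ?_
  rw [Matrix.diag_apply, Matrix.mul_apply, Complex.re_sum]
  refine Finset.sum_congr rfl fun j _ => ?_
  rw [Matrix.mul_diagonal, Matrix.diagonal_mul, Matrix.conjTranspose_apply]
  set w := (U.conjTranspose * V) i j
  have : (d i : ℂ) * w * d' j * star w = ((d i * d' j * Complex.normSq w : ℝ) : ℂ) := by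
    push_cast
    rw [← Complex.mul_conj, Complex.star_def]
    ring
  rw [this, Complex.ofReal_re]

theorem exists_eq_ofSpectrum {A : Matrix m m ℂ} (hA : A.IsHermitian) :
    ∃ U : Matrix m m ℂ, U.conjTranspose * U = 1 ∧ A = ofSpectrum U hA.eigenvalues :=
  ⟨hA.eigenvectorUnitary, Matrix.mem_unitaryGroup_iff'.1 hA.eigenvectorUnitary.2,
    hA.spectral_theorem⟩

theorem exists_eq_mul_self {P : Matrix m m ℂ} (hP : P.PosSemidef) :
    ∃ B : Matrix m m ℂ, B.conjTranspose = B ∧ P = B * B := by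
  obtain ⟨U, hU, h⟩ := exists_eq_ofSpectrum hP.isHermitian
  set d := hP.isHermitian.eigenvalues
  refine ⟨ofSpectrum U fun i => Real.sqrt (d i),
    (ofSpectrum_posSemidef U fun i => Real.sqrt_nonneg _).isHermitian, ?_⟩
  have hd : ∀ i, 0 ≤ d i := hP.eigenvalues_nonneg
  rw [ofSpectrum_mul hU, h]
  congr 1
  funext i
  exact (Real.mul_self_sqrt (hd i)).symm

theorem trace_mul_re_nonneg {P Q : Matrix m m ℂ} (hP : P.PosSemidef) (hQ : Q.PosSemidef) :
    0 ≤ (P * Q).trace.re := by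
  obtain ⟨B, hB, rfl⟩ := exists_eq_mul_self hP
  have h := (hQ.mul_mul_conjTranspose_same B).trace_nonneg
  rw [hB] at h
  rw [Matrix.mul_assoc, Matrix.trace_mul_comm]
  exact (Complex.le_def.1 h).1

/-- The trace of the exponential of a Hermitian operator. -/
def traceExp (A : Matrix m m ℂ) : ℝ :=
  if h : A.IsHermitian then ∑ i, Real.exp (h.eigenvalues i) else 0

theorem trace_ofSpectrum {U : Matrix m m ℂ} (hU : U.conjTranspose * U = 1) (d : m → ℝ) :
    (ofSpectrum U d).trace.re = ∑ i, d i := by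
  rw [ofSpectrum, Matrix.trace_mul_comm, ← Matrix.mul_assoc, hU, Matrix.one_mul,
    Matrix.trace_diagonal, Complex.re_sum]
  simp

/-- A second-order bound for the trace of the exponential. -/
theorem exists_traceExp_le {A : Matrix m m ℂ} (hA : A.IsHermitian) :
    ∃ E : Matrix m m ℂ, ∀ (B : Matrix m m ℂ) (c : ℝ), B.IsHermitian →
      ((c : ℂ) • 1 - (B - A) * (B - A)).PosSemidef →
        (1 - c / 2) * traceExp B ≤ (1 + c / 2) * traceExp A + (E * (B - A)).trace.re := by
  obtain ⟨U, hU, hAU⟩ := exists_eq_ofSpectrum hA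
  set a := hA.eigenvalues with ha
  -- The first-order coefficient is the exponential of `A`.
  refine ⟨ofSpectrum U fun i => Real.exp (a i), fun B c hB hc => ?_⟩
  obtain ⟨V, hV, hBV⟩ := exists_eq_ofSpectrum hB
  set b := hB.eigenvalues with hb
  set EA := ofSpectrum U fun i => Real.exp (a i) with hEA
  set EB := ofSpectrum V fun i => Real.exp (b i) with hEB
  have tA : traceExp A = EA.trace.re := by rw [traceExp, dif_pos hA, trace_ofSpectrum hU]
  have tB : traceExp B = EB.trace.re := by rw [traceExp, dif_pos hB, trace_ofSpectrum hV]
  have sq {E : Matrix m m ℂ} (hE : E.PosSemidef) :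
      (E * ((B - A) * (B - A))).trace.re ≤ c * E.trace.re := by
    have := trace_mul_re_nonneg hE hc
    rw [Matrix.mul_sub, Matrix.trace_sub, Complex.sub_re, Matrix.mul_smul, Matrix.mul_one,
      Matrix.trace_smul, smul_eq_mul, Complex.re_ofReal_mul] at this
    linarith
  have sA := sq (ofSpectrum_posSemidef U fun i => (Real.exp_pos (a i)).le)
  have sB := sq (ofSpectrum_posSemidef V fun i => (Real.exp_pos (b i)).le)
  rw [← hEA] at sA
  rw [← hEB] at sB
  -- The identities below write each trace as a combination of values of `F`, that is, as a double
  -- sum over pairs of eigenvalues of `A` and `B`. Only `A` with its exponential, and `B` with its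
  -- own, need to commute.
  let F (d d' : m → ℝ) : ℝ := (ofSpectrum U d * ofSpectrum V d').trace.re
  have f1 : EB.trace.re = F (fun _ => 1) (fun j => Real.exp (b j)) := by
    simp only [F, ofSpectrum_one hU, Matrix.one_mul, hEB]
  have f2 : EA.trace.re = F (fun i => Real.exp (a i)) (fun _ => 1) := by
    simp only [F, ofSpectrum_one hV, Matrix.mul_one, hEA]
  have f3 : (EA * (B - A)).trace.re = F (fun i => Real.exp (a i)) b -
      F (fun i => Real.exp (a i) * a i) (fun _ => 1) := by
    simp only [F, ofSpectrum_one hV, Matrix.mul_one, ← ofSpectrum_mul hU, ← hBV, ← hAU, ← hEA]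
    rw [Matrix.mul_sub, Matrix.trace_sub, Complex.sub_re]
  have f4 : (EA * ((B - A) * (B - A))).trace.re = F (fun i => Real.exp (a i)) (fun j => b j * b j) -
      2 * F (fun i => Real.exp (a i) * a i) b +
        F (fun i => Real.exp (a i) * a i * a i) (fun _ => 1) := by
    simp only [F, ofSpectrum_one hV, Matrix.mul_one, ← ofSpectrum_mul hU, ← ofSpectrum_mul hV,
      ← hBV, ← hAU, ← hEA]
    have comm : EA * A = A * EA := by
      rw [hAU, hEA, ofSpectrum_mul hU, ofSpectrum_mul hU]
      simp only [mul_comm]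
    have e : (EA * (B * A)).trace = (EA * A * B).trace := by
      rw [comm, ← Matrix.mul_assoc, Matrix.trace_mul_comm, Matrix.mul_assoc]
    have : (EA * ((B - A) * (B - A))).trace = (EA * (B * B)).trace - (EA * (B * A)).trace -
        (EA * A * B).trace + (EA * A * A).trace := by
      simp only [Matrix.mul_sub, Matrix.sub_mul, Matrix.trace_sub, Matrix.mul_assoc]
      ring
    rw [this, e, Complex.add_re, Complex.sub_re, Complex.sub_re]
    ring
  have f5 : (EB * ((B - A) * (B - A))).trace.re =
      F (fun _ => 1) (fun j => b j * b j * Real.exp (b j)) -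
      2 * F a (fun j => b j * Real.exp (b j)) + F (fun i => a i * a i) (fun j => Real.exp (b j)) := by
    simp only [F, ofSpectrum_one hU, Matrix.one_mul, ← ofSpectrum_mul hU, ← ofSpectrum_mul hV,
      ← hBV, ← hAU, ← hEB]
    have comm : EB * B = B * EB := by
      rw [hBV, hEB, ofSpectrum_mul hV, ofSpectrum_mul hV]
      simp only [mul_comm]
    have e1 : (EB * (B * B)).trace = (B * B * EB).trace := Matrix.trace_mul_comm _ _
    have e2 : (EB * (B * A)).trace = (A * (B * EB)).trace := by
      rw [← Matrix.mul_assoc, comm, Matrix.trace_mul_comm]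
    have e3 : (EB * (A * B)).trace = (A * (B * EB)).trace := by
      rw [Matrix.trace_mul_comm, Matrix.mul_assoc]
    have e4 : (EB * (A * A)).trace = (A * A * EB).trace := Matrix.trace_mul_comm _ _
    have : (EB * ((B - A) * (B - A))).trace = (EB * (B * B)).trace - (EB * (B * A)).trace -
        (EB * (A * B)).trace + (EB * (A * A)).trace := by
      simp only [Matrix.mul_sub, Matrix.sub_mul, Matrix.trace_sub]
      ring
    rw [this, e1, e2, e3, e4, Complex.add_re, Complex.sub_re, Complex.sub_re]
    ring
  have main : EB.trace.re ≤ EA.trace.re + (EA * (B - A)).trace.re +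
      ((EA * ((B - A) * (B - A))).trace.re + (EB * ((B - A) * (B - A))).trace.re) / 2 := by
    rw [f3, f4, f5, f1, f2]
    simp only [F, trace_ofSpectrum_mul_ofSpectrum]
    have : 0 ≤ ∑ i, ∑ j, (Real.exp (a i) + Real.exp (a i) * (b j - a i) +
        (Real.exp (a i) + Real.exp (b j)) * (b j - a i) ^ 2 / 2 - Real.exp (b j)) *
          Complex.normSq ((U.conjTranspose * V) i j) :=
      Finset.sum_nonneg fun i _ => Finset.sum_nonneg fun j _ =>
        mul_nonneg (sub_nonneg.2 (exp_le_taylor_symm _ _)) (Complex.normSq_nonneg _)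
    rw [← sub_nonneg]
    refine this.trans (le_of_eq ?_)
    simp only [Finset.mul_sum, ← Finset.sum_sub_distrib, ← Finset.sum_add_distrib, Finset.sum_div]
    refine Finset.sum_congr rfl fun i _ => Finset.sum_congr rfl fun j _ => ?_
    ring
  rw [tA, tB]
  linarith

/-- The exponential of each eigenvalue is one of the positive terms of the trace. -/
theorem posSemidef_of_traceExp_le {A : Matrix m m ℂ} (hA : A.IsHermitian) {R : ℝ}
    (h : traceExp A ≤ R) : (((Real.log R : ℝ) : ℂ) • 1 - A).PosSemidef := by
  obtain ⟨U, hU, hAU⟩ := exists_eq_ofSpectrum hA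
  rw [traceExp, dif_pos hA] at h
  have : ((Real.log R : ℝ) : ℂ) • 1 - A = ofSpectrum U fun i => Real.log R - hA.eigenvalues i := by
    set a := hA.eigenvalues
    rw [hAU, ← ofSpectrum_one hU]
    simp only [ofSpectrum, ← Matrix.smul_mul, ← Matrix.sub_mul]
    congr 1
    ext i j
    by_cases hij : i = j
    · subst hij; simp; ring
    · simp; ring
  rw [this]
  refine ofSpectrum_posSemidef U fun i => sub_nonneg.2 ?_
  have hi : Real.exp (hA.eigenvalues i) ≤ R := (Finset.single_le_sum
    (f := fun i => Real.exp (hA.eigenvalues i)) (fun _ _ => (Real.exp_pos _).le)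
    (Finset.mem_univ i)).trans h
  rw [← Real.log_exp (hA.eigenvalues i)]
  exact Real.log_le_log (Real.exp_pos _) hi

theorem traceExp_nonneg (A : Matrix m m ℂ) : 0 ≤ traceExp A := by
  unfold traceExp
  split_ifs
  · exact Finset.sum_nonneg fun _ _ => (Real.exp_pos _).le
  · exact le_rfl

theorem traceExp_zero : traceExp (0 : Matrix m m ℂ) = Fintype.card m := by
  have h : (0 : Matrix m m ℂ).IsHermitian := Matrix.isHermitian_zero
  rw [traceExp, dif_pos h]
  have : h.eigenvalues = 0 := h.eigenvalues_eq_zero_iff.2 rfl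
  simp [this]

/-- Twice the operator is a sum of two congruences, of `1 + Y` by `1 - Y` and of `1 - Y` by `1 + Y`.
-/
theorem one_sub_sq_posSemidef {Y : Matrix m m ℂ} (h1 : (1 - Y).PosSemidef)
    (h2 : (1 + Y).PosSemidef) : (1 - Y * Y).PosSemidef := by
  have e1 : (1 - Y) * (1 + Y) * (1 - Y) + (1 + Y) * (1 - Y) * (1 + Y) = (2 : ℂ) • (1 - Y * Y) := by
    rw [two_smul]; noncomm_ring
  have k1 := h2.conjTranspose_mul_mul_same (1 - Y)
  have k2 := h1.conjTranspose_mul_mul_same (1 + Y)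
  rw [h1.isHermitian.eq] at k1
  rw [h2.isHermitian.eq] at k2
  have := (k1.add k2).smul (a := (2 : ℂ)⁻¹) (by simp)
  rwa [e1, smul_smul, inv_mul_cancel₀ two_ne_zero, one_smul] at this

/-- The first-order terms average to zero under `p`, so they cannot be positive for every `i` with
`p i ≠ 0`. Following `S` and `-S` together gives a bound on both sides. -/
theorem exists_traceExp_step {ι : Type} [Fintype ι] (p : ι → ℝ) (hp : ∀ i, 0 ≤ p i)
    (hp1 : ∑ i, p i = 1) {S : Matrix m m ℂ} (hS : S.IsHermitian) (X : ι → Matrix m m ℂ)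
    (hX : ∀ i, (X i).IsHermitian) (hX0 : ∑ i, (p i : ℂ) • X i = 0) {c : ℝ}
    (hc : ∀ i, ((c : ℂ) • 1 - X i * X i).PosSemidef) :
    ∃ i, (1 - c / 2) * (traceExp (S + X i) + traceExp (-(S + X i))) ≤
      (1 + c / 2) * (traceExp S + traceExp (-S)) := by
  obtain ⟨E, hE⟩ := exists_traceExp_le hS
  obtain ⟨E', hE'⟩ := exists_traceExp_le hS.neg
  by_contra! hcon
  have hsum : ∑ i, p i * ((E * X i).trace.re + (E' * -X i).trace.re) = 0 := by
    have e (E : Matrix m m ℂ) : ∑ i, p i * (E * X i).trace.re = 0 := by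
      have : (E * ∑ i, (p i : ℂ) • X i).trace.re = ∑ i, p i * (E * X i).trace.re := by
        rw [Matrix.mul_sum, Matrix.trace_sum, Complex.re_sum]
        refine Finset.sum_congr rfl fun i _ => ?_
        rw [Matrix.mul_smul, Matrix.trace_smul, smul_eq_mul, Complex.re_ofReal_mul]
      rw [← this, hX0]
      simp
    have e2 := e (-E')
    simp only [Matrix.neg_mul] at e2
    simp only [Matrix.mul_neg, mul_add, Finset.sum_add_distrib, e, e2, add_zero]
  have hle (i : ι) : (1 - c / 2) * (traceExp (S + X i) + traceExp (-(S + X i))) ≤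
      (1 + c / 2) * (traceExp S + traceExp (-S)) +
        ((E * X i).trace.re + (E' * -X i).trace.re) := by
    have h1 := hE (S + X i) c (hS.add (hX i)) (by simpa using hc i)
    have h2 := hE' (-(S + X i)) c (hS.add (hX i)).neg (by
      have : -(S + X i) - -S = - X i := by abel
      rw [this]
      simpa using hc i)
    have : -(S + X i) - -S = - X i := by abel
    rw [this] at h2
    rw [add_sub_cancel_left] at h1
    linarith
  have hlt (i : ι) : 0 ≤ p i * ((E * X i).trace.re + (E' * -X i).trace.re) :=
    mul_nonneg (hp i) (by linarith [hle i, hcon i])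
  have hz := (Finset.sum_eq_zero_iff_of_nonneg fun i _ => hlt i).1 hsum
  obtain ⟨i, hi⟩ : ∃ i, p i ≠ 0 := by
    by_contra! h
    simp [h] at hp1
  have := hz i (Finset.mem_univ i)
  rcases mul_eq_zero.1 this with h | h
  · exact hi h
  · linarith [hle i, hcon i]

theorem exists_traceExp_path {ι : Type} [Fintype ι] (p : ι → ℝ) (hp : ∀ i, 0 ≤ p i)
    (hp1 : ∑ i, p i = 1) (X : ι → Matrix m m ℂ)
    (hX : ∀ i, (X i).IsHermitian) (hX0 : ∑ i, (p i : ℂ) • X i = 0) {c : ℝ} (hc0 : 0 ≤ c) (hc1 : c ≤ 1)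
    (hc : ∀ i, ((c : ℂ) • 1 - X i * X i).PosSemidef) (t : ℕ) :
    ∃ f : ℕ → ι, traceExp (∑ k ∈ Finset.range t, X (f k)) +
      traceExp (-∑ k ∈ Finset.range t, X (f k)) ≤
        ((1 + c / 2) / (1 - c / 2)) ^ t * (2 * Fintype.card m) := by
  induction t with
  | zero =>
    obtain ⟨i, -⟩ : ∃ i, p i ≠ 0 := by
      by_contra! h
      simp [h] at hp1
    exact ⟨fun _ => i, by simp [traceExp_zero, two_mul]⟩
  | succ t ih =>
    obtain ⟨f, hf⟩ := ih
    have hS : (∑ k ∈ Finset.range t, X (f k)).IsHermitian := by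
      rw [Matrix.IsHermitian, Matrix.conjTranspose_sum]
      exact Finset.sum_congr rfl fun k _ => hX _
    obtain ⟨i, hi⟩ := exists_traceExp_step p hp hp1 hS X hX hX0 hc
    refine ⟨Function.update f t i, ?_⟩
    have e : ∑ k ∈ Finset.range (t + 1), X (Function.update f t i k) =
        ∑ k ∈ Finset.range t, X (f k) + X i := by
      rw [Finset.sum_range_succ, Function.update_self]
      congr 1
      refine Finset.sum_congr rfl fun k hk => ?_
      rw [Function.update_of_ne (Finset.mem_range.1 hk).ne]
    rw [e]
    have h0 : 0 < 1 - c / 2 := by linarith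
    rw [pow_succ, mul_assoc, mul_comm _ (2 * _), ← mul_assoc]
    have : ((1 + c / 2) / (1 - c / 2)) * (traceExp (∑ k ∈ Finset.range t, X (f k)) +
      traceExp (-∑ k ∈ Finset.range t, X (f k))) ≥ traceExp (∑ k ∈ Finset.range t, X (f k) + X i) +
        traceExp (-(∑ k ∈ Finset.range t, X (f k) + X i)) := by
      rw [ge_iff_le, div_mul_eq_mul_div, le_div_iff₀ h0]
      linarith
    refine ge_iff_le.1 this |>.trans ?_
    rw [mul_comm]
    exact mul_le_mul_of_nonneg_right hf (div_nonneg (by linarith) h0.le)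

/-- Every convex combination of operators between `0` and `1` is close to a short average of them. -/
theorem exists_average_close [Nonempty m] {ι : Type} [Fintype ι] (p : ι → ℝ) (hp : ∀ i, 0 ≤ p i)
    (hp1 : ∑ i, p i = 1) (M : ι → Matrix m m ℂ) (hM : ∀ i, (M i).PosSemidef)
    (hM1 : ∀ i, (1 - M i).PosSemidef) {δ : ℝ} (hδ : 0 < δ) (hδ1 : δ ≤ 1) (t : ℕ) (ht : 0 < t)
    (hlog : 8 * Real.log (2 * Fintype.card m) ≤ t * δ ^ 2) :
    ∃ f : ℕ → ι,
      ((δ : ℂ) • 1 - (∑ i, (p i : ℂ) • M i - (t : ℂ)⁻¹ • ∑ k ∈ Finset.range t, M (f k))).PosSemidef ∧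
      ((δ : ℂ) • 1 + (∑ i, (p i : ℂ) • M i - (t : ℂ)⁻¹ • ∑ k ∈ Finset.range t, M (f k))).PosSemidef := by
  set Mb := ∑ i, (p i : ℂ) • M i with hMb
  have hpc : ∑ i, (p i : ℂ) = 1 := by exact_mod_cast hp1
  have hMb0 : Mb.PosSemidef :=
    Matrix.posSemidef_sum _ fun i _ => (hM i).smul (by exact_mod_cast hp i)
  have hMb1 : (1 - Mb).PosSemidef := by
    have : 1 - Mb = ∑ i, (p i : ℂ) • (1 - M i) := by
      simp only [smul_sub, Finset.sum_sub_distrib, ← Finset.sum_smul, hpc, one_smul, hMb]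
    rw [this]
    exact Matrix.posSemidef_sum _ fun i _ => (hM1 i).smul (by exact_mod_cast hp i)
  -- With this scale the growth contributes at most `2 * θ ^ 2 * t = t * δ ^ 2 / 8` to `Real.log R`,
  -- and the dimension at most as much by `hlog`; together they make `θ * t * δ`.
  set θ : ℝ := δ / 4 with hθ
  have hθ0 : 0 < θ := by positivity
  let X (i : ι) : Matrix m m ℂ := (θ : ℂ) • (Mb - M i)
  have hX (i : ι) : (X i).IsHermitian := by
    rw [Matrix.IsHermitian, Matrix.conjTranspose_smul, Complex.star_def, Complex.conj_ofReal,
      Matrix.conjTranspose_sub, hMb0.isHermitian.eq, (hM i).isHermitian.eq]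
  have hX0 : ∑ i, (p i : ℂ) • X i = 0 := by
    simp only [X, smul_comm _ (θ : ℂ), ← Finset.smul_sum, smul_sub, Finset.sum_sub_distrib,
      ← Finset.sum_smul, hpc, one_smul, ← hMb, sub_self]
  have hc (i : ι) : (((θ ^ 2 : ℝ) : ℂ) • 1 - X i * X i).PosSemidef := by
    have h1 : (1 - (Mb - M i)).PosSemidef := by
      have := hMb1.add (hM i)
      rwa [show 1 - Mb + M i = 1 - (Mb - M i) by abel] at this
    have h2 : (1 + (Mb - M i)).PosSemidef := by
      have := hMb0.add (hM1 i)
      rwa [show Mb + (1 - M i) = 1 + (Mb - M i) by abel] at this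
    have h3 := (one_sub_sq_posSemidef h1 h2).smul (a := ((θ ^ 2 : ℝ) : ℂ))
      (by exact_mod_cast sq_nonneg θ)
    have e : X i * X i = ((θ ^ 2 : ℝ) : ℂ) • ((Mb - M i) * (Mb - M i)) := by
      simp only [X, Matrix.smul_mul, Matrix.mul_smul, smul_smul]
      congr 1; push_cast; ring
    rwa [smul_sub, ← e] at h3
  have hθ1 : θ ^ 2 ≤ 1 := by nlinarith
  obtain ⟨f, hf⟩ := exists_traceExp_path p hp hp1 X hX hX0 (sq_nonneg θ) hθ1 hc t
  refine ⟨f, ?_⟩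
  set S := ∑ k ∈ Finset.range t, X (f k) with hSdef
  set D := Mb - (t : ℂ)⁻¹ • ∑ k ∈ Finset.range t, M (f k) with hD
  have htc : (t : ℂ) ≠ 0 := by exact_mod_cast ht.ne'
  have hSD : S = ((θ * t : ℝ) : ℂ) • D := by
    simp only [hSdef, X, ← Finset.smul_sum, Finset.sum_sub_distrib, Finset.sum_const,
      Finset.card_range, hD]
    push_cast
    rw [← smul_smul, smul_sub (t : ℂ), smul_smul (t : ℂ), mul_inv_cancel₀ htc, one_smul,
      Nat.cast_smul_eq_nsmul]
  have hS : S.IsHermitian := by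
    rw [Matrix.IsHermitian, hSdef, Matrix.conjTranspose_sum]
    exact Finset.sum_congr rfl fun k _ => hX _
  set R := ((1 + θ ^ 2 / 2) / (1 - θ ^ 2 / 2)) ^ t * (2 * Fintype.card m) with hR
  have hN : (0 : ℝ) < 2 * Fintype.card m := by
    have := Fintype.card_pos (α := m); positivity
  have h0 : 0 < 1 - θ ^ 2 / 2 := by linarith
  have hlogR : Real.log R ≤ θ * t * δ := by
    have hk : (1 + θ ^ 2 / 2) / (1 - θ ^ 2 / 2) ≤ Real.exp (2 * θ ^ 2) := by
      rw [div_le_iff₀ h0]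
      have h1 := Real.add_one_le_exp (2 * θ ^ 2)
      nlinarith
    have hk0 : 0 < (1 + θ ^ 2 / 2) / (1 - θ ^ 2 / 2) := div_pos (by positivity) h0
    rw [hR, Real.log_mul (by positivity) hN.ne', Real.log_pow]
    have h2 : Real.log ((1 + θ ^ 2 / 2) / (1 - θ ^ 2 / 2)) ≤ 2 * θ ^ 2 := by
      rw [← Real.log_exp (2 * θ ^ 2)]
      exact Real.log_le_log hk0 hk
    have h3 := mul_le_mul_of_nonneg_left h2 (Nat.cast_nonneg (α := ℝ) t)
    rw [hθ] at h3 ⊢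
    nlinarith
  have fin {Y : Matrix m m ℂ} (hY : (((Real.log R : ℝ) : ℂ) • 1 - ((θ * t : ℝ) : ℂ) • Y).PosSemidef) :
      ((δ : ℂ) • 1 - Y).PosSemidef := by
    have hpos : 0 < θ * t := by positivity
    have h1 : (((θ * t * δ - Real.log R : ℝ) : ℂ) • (1 : Matrix m m ℂ)).PosSemidef :=
      Matrix.PosSemidef.one.smul (by exact_mod_cast sub_nonneg.2 hlogR)
    have h2 := (h1.add hY).smul (a := (((θ * t)⁻¹ : ℝ) : ℂ)) (by exact_mod_cast (inv_pos.2 hpos).le)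
    have e : (((θ * t)⁻¹ : ℝ) : ℂ) • (((θ * t * δ - Real.log R : ℝ) : ℂ) • (1 : Matrix m m ℂ) +
        (((Real.log R : ℝ) : ℂ) • 1 - ((θ * t : ℝ) : ℂ) • Y)) = (δ : ℂ) • 1 - Y := by
      rw [add_sub, ← add_smul, smul_sub, smul_smul, smul_smul, ← Complex.ofReal_add,
        ← Complex.ofReal_mul, ← Complex.ofReal_mul, sub_add_cancel, inv_mul_cancel₀ hpos.ne',
        ← mul_assoc, inv_mul_cancel₀ hpos.ne', one_mul, Complex.ofReal_one, one_smul]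
    rwa [e] at h2
  constructor
  · apply fin
    rw [← hSD]
    exact posSemidef_of_traceExp_le hS (by linarith [traceExp_nonneg (-S)])
  · rw [← sub_neg_eq_add]
    apply fin
    rw [smul_neg, ← hSD]
    exact posSemidef_of_traceExp_le hS.neg (by linarith [traceExp_nonneg S])

end Spectral

/-! ### Compactness and convexity of the constraint sets -/

section Compactness

variable {m : Type} [Fintype m] [DecidableEq m]

theorem isClosed_posSemidef : IsClosed {M : Matrix m m ℂ | M.PosSemidef} := by
  have : {M : Matrix m m ℂ | M.PosSemidef} = {M | M.conjTranspose = M} ∩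
      ⋂ x : m → ℂ, {M | 0 ≤ dotProduct (star x) (M.mulVec x)} := by
    ext M
    simp only [Set.mem_ofPred_eq, Set.mem_inter_iff, Set.mem_iInter]
    exact Matrix.posSemidef_iff_dotProduct_mulVec
  rw [this]
  refine (isClosed_eq (by fun_prop) continuous_id).inter (isClosed_iInter fun x => ?_)
  exact isClosed_le continuous_const (by fun_prop)

theorem norm_apply_le_one {M : Matrix m m ℂ} (hM : M.PosSemidef) (htr : M.trace = 1) (i j : m) :
    ‖M i j‖ ≤ 1 := by
  obtain ⟨B, hB, rfl⟩ := exists_eq_mul_self hM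
  have hs (i k : m) : B k i = star (B i k) := by
    conv_lhs => rw [← hB]
    rfl
  have hrow (i : m) : ∑ k, ‖B i k‖ ^ 2 ≤ 1 := by
    have h1 : ∑ i, ∑ k, ‖B i k‖ ^ 2 = 1 := by
      have h2 : (((∑ i, ∑ k, ‖B i k‖ ^ 2 : ℝ)) : ℂ) = 1 := by
        rw [← htr, Matrix.trace]
        push_cast
        refine Finset.sum_congr rfl fun i _ => ?_
        rw [Matrix.diag_apply, Matrix.mul_apply]
        refine Finset.sum_congr rfl fun k _ => ?_
        rw [hs i k, Complex.star_def, Complex.mul_conj, Complex.normSq_eq_norm_sq]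
        push_cast; rfl
      exact_mod_cast h2
    rw [← h1]
    exact Finset.single_le_sum (f := fun i => ∑ k, ‖B i k‖ ^ 2)
      (fun _ _ => Finset.sum_nonneg fun _ _ => sq_nonneg _) (Finset.mem_univ i)
  rw [Matrix.mul_apply]
  have h3 (k : m) : ‖B i k * B k j‖ ≤ (‖B i k‖ ^ 2 + ‖B j k‖ ^ 2) / 2 := by
    rw [norm_mul, hs j k, norm_star]
    nlinarith [sq_nonneg (‖B i k‖ - ‖B j k‖)]
  calc ‖∑ k, B i k * B k j‖ ≤ ∑ k, (‖B i k‖ ^ 2 + ‖B j k‖ ^ 2) / 2 :=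
        (norm_sum_le _ _).trans (Finset.sum_le_sum fun k _ => h3 k)
    _ = (∑ k, ‖B i k‖ ^ 2 + ∑ k, ‖B j k‖ ^ 2) / 2 := by
        rw [← Finset.sum_add_distrib, Finset.sum_div]
    _ ≤ 1 := by linarith [hrow i, hrow j]

theorem isCompact_isDensity {n : ℕ} : IsCompact {ρ : QOp n | IsDensity ρ} := by
  have hc : IsCompact (X := QOp n) (Set.univ.pi fun _ => Set.univ.pi fun _ =>
      Metric.closedBall (0 : ℂ) 1) :=
    isCompact_univ_pi (X := fun _ : Qubits n => Qubits n → ℂ)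
      fun _ => isCompact_univ_pi (X := fun _ : Qubits n => ℂ)
        fun _ => isCompact_closedBall (0 : ℂ) 1
  refine hc.of_isClosed_subset ?_ fun ρ hρ i _ j _ => ?_
  · exact isClosed_posSemidef.inter (isClosed_eq (by fun_prop) continuous_const)
  · rw [mem_closedBall_zero_iff]
    exact norm_apply_le_one hρ.1 hρ.2 i j

theorem convex_isDensity {n : ℕ} : Convex ℝ {ρ : QOp n | IsDensity ρ} := by
  intro ρ hρ σ hσ a b ha hb hab
  refine ⟨(hρ.1.smul ha).add (hσ.1.smul hb), ?_⟩
  rw [Matrix.trace_add, Matrix.trace_smul, Matrix.trace_smul, hρ.2, hσ.2, ← add_smul, hab, one_smul]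

end Compactness

/-- The infimum is attained: the admissible exponents are upward closed because `σ` is positive, and
closed because the positive cone is. The entropy bound becomes a linear matrix inequality, from
which convexity and closedness are read off. -/
theorem relMinEntropy_le_iff {n : ℕ} {ρ σ : QOp n} (hσ : σ.PosSemidef) (l : ℝ) :
    relMinEntropy ρ σ ≤ l ↔ ((((2 : ℝ) ^ l : ℝ) : ℂ) • σ - ρ).PosSemidef := by
  constructor
  · intro h
    have hgt (l' : ℝ) (hl : l < l') : ((((2 : ℝ) ^ l' : ℝ) : ℂ) • σ - ρ).PosSemidef := by
      have h1 : relMinEntropy ρ σ < (l' : EReal) := h.trans_lt (by exact_mod_cast hl)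
      obtain ⟨_, ⟨x, hx, rfl⟩, hxl⟩ := sInf_lt_iff.1 h1
      have hxl : x < l' := EReal.coe_lt_coe_iff.1 hxl
      have h2 : (2 : ℝ) ^ x ≤ 2 ^ l' := Real.rpow_le_rpow_of_exponent_le (by norm_num) hxl.le
      have h3 : ((((2 : ℝ) ^ l' - (2 : ℝ) ^ x : ℝ) : ℂ) • σ).PosSemidef :=
        hσ.smul (by exact_mod_cast sub_nonneg.2 h2)
      have h4 := h3.add hx
      rw [add_sub, ← add_smul, ← Complex.ofReal_add, sub_add_cancel] at h4
      exact h4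
    have hcont : Continuous fun x : ℝ => (((2 : ℝ) ^ x : ℝ) : ℂ) • σ - ρ := by
      have : Continuous fun x : ℝ => (2 : ℝ) ^ x := Real.continuous_const_rpow (by norm_num)
      fun_prop
    exact isClosed_posSemidef.mem_of_tendsto
      ((hcont.tendsto l).mono_left (nhdsWithin_le_nhds (s := Set.Ioi l)))
      (Filter.eventually_of_mem self_mem_nhdsWithin hgt)
  · intro h
    exact sInf_le ⟨l, h, rfl⟩

/-! ### The minimax argument -/

section Minimax

variable {G : GateSet} {n : ℕ}

theorem trace_mul_density_le {D τ : QOp n} {δ : ℝ} (hD : ((δ : ℂ) • 1 - D).PosSemidef)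
    (hτ : IsDensity τ) : (D * τ).trace.re ≤ δ := by
  have h := trace_mul_re_nonneg hD hτ.1
  rw [Matrix.sub_mul, Matrix.smul_mul, Matrix.one_mul, Matrix.trace_sub, Matrix.trace_smul, hτ.2,
    smul_eq_mul, mul_one, Complex.sub_re, Complex.ofReal_re] at h
  linarith

/-- If every state in a compact convex set is exposed by some test of a family, then all of them
are exposed by one convex combination of tests. -/
theorem exists_convex_combination {K : Set (QOp n)} (hc : Convex ℝ K) (hk : IsCompact K)
    (hne : K.Nonempty) (β : QOp n) (E : Set (QOp n)) (c : ℝ)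
    (h : ∀ τ ∈ K, ∃ M ∈ E, c < (M * (β - τ)).trace.re) :
    ∃ (ι : Type) (_ : Fintype ι) (M : ι → QOp n) (p : ι → ℝ), (∀ i, M i ∈ E) ∧ (∀ i, 0 ≤ p i) ∧
      ∑ i, p i = 1 ∧ ∀ τ ∈ K, c < ((∑ i, (p i : ℂ) • M i) * (β - τ)).trace.re := by
  have hcont (M : QOp n) : Continuous fun τ : QOp n => (M * (β - τ)).trace.re := by fun_prop
  -- The family of tests may be infinite. Strict inequalities are open conditions on τ, so finitely
  -- many tests suffice, and the mixed strategies form a compact simplex.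
  obtain ⟨F, hF⟩ := hk.elim_finite_subcover
    (fun M : E => {τ : QOp n | c < ((M : QOp n) * (β - τ)).trace.re})
    (fun M => isOpen_lt continuous_const (hcont M))
    (fun τ hτ => by
      obtain ⟨M, hM, h1⟩ := h τ hτ
      exact Set.mem_iUnion.2 ⟨⟨M, hM⟩, h1⟩)
  have hF' (τ) (hτ : τ ∈ K) : ∃ i : F, c < ((i.1 : QOp n) * (β - τ)).trace.re := by
    obtain ⟨M, hM, h1⟩ := Set.mem_iUnion₂.1 (hF hτ)
    exact ⟨⟨M, hM⟩, h1⟩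
  obtain ⟨τ₀, hτ₀⟩ := hne
  obtain ⟨i₀, -⟩ := hF' τ₀ hτ₀
  let f (τ : QOp n) (y : F → ℝ) : ℝ := ∑ i, y i * ((i.1 : QOp n) * (β - τ)).trace.re
  obtain ⟨a, ha, b, hb, hab⟩ := Sion.exists_isSaddlePointOn (X := K) (Y := stdSimplex ℝ F) (f := f)
    ⟨τ₀, hτ₀⟩ hc hk
    (fun y _ => Continuous.lowerSemicontinuous (by fun_prop) |>.lowerSemicontinuousOn _)
    (fun y _ => by
      refine ConvexOn.quasiconvexOn ⟨hc, fun x _ z _ r s hr hs hrs => le_of_eq ?_⟩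
      simp only [f, smul_eq_mul, Finset.mul_sum, ← Finset.sum_add_distrib]
      refine Finset.sum_congr rfl fun i _ => ?_
      have e : β - (r • x + s • z) = r • (β - x) + s • (β - z) := by
        conv_lhs => rw [← one_smul ℝ β, ← hrs, add_smul]
        rw [smul_sub, smul_sub]; abel
      rw [e, Matrix.mul_add, Matrix.mul_smul, Matrix.mul_smul, Matrix.trace_add, Matrix.trace_smul,
        Matrix.trace_smul, Complex.add_re, Complex.smul_re, Complex.smul_re, smul_eq_mul,
        smul_eq_mul]
      ring)
    (convex_stdSimplex ℝ F) ⟨Pi.single i₀ 1, single_mem_stdSimplex ℝ i₀⟩ (isCompact_stdSimplex ℝ F)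
    (fun x _ => Continuous.upperSemicontinuous (by fun_prop) |>.upperSemicontinuousOn _)
    (fun x _ => by
      refine ConcaveOn.quasiconcaveOn ⟨convex_stdSimplex ℝ F, fun y _ z _ r s _ _ _ => le_of_eq ?_⟩
      simp only [f, smul_eq_mul, Finset.mul_sum, ← Finset.sum_add_distrib, Pi.add_apply,
        Pi.smul_apply]
      refine Finset.sum_congr rfl fun i _ => ?_
      ring)
  refine ⟨F, inferInstance, fun i => i.1, b, fun i => i.1.2, hb.1, hb.2, fun τ hτ => ?_⟩
  -- At the saddle point, the mixture `b` does at least as well against any τ as the pure test `i`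
  -- does against `a`.
  obtain ⟨i, hi⟩ := hF' a ha
  have h1 := hab τ hτ (Pi.single i 1) (single_mem_stdSimplex ℝ i)
  have h2 : f a (Pi.single i 1) = ((i.1 : QOp n) * (β - a)).trace.re := by
    simp [f, Pi.single_apply]
  have h3 : f τ b = ((∑ i, (b i : ℂ) • (i.1 : QOp n)) * (β - τ)).trace.re := by
    rw [Matrix.sum_mul, Matrix.trace_sum, Complex.re_sum]
    refine Finset.sum_congr rfl fun i _ => ?_
    rw [Matrix.smul_mul, Matrix.trace_smul, smul_eq_mul, Complex.re_ofReal_mul]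
  rw [← h3]
  exact (h2 ▸ hi).trans_le h1

end Minimax

/-! ### Assembly of the two ingredients -/

section Main

variable {G : GateSet} {n : ℕ}

theorem isDensity_unique (ρ σ : QOp 0) (hρ : IsDensity ρ) (hσ : IsDensity σ) : ρ = σ := by
  have h (τ : QOp 0) (hτ : IsDensity τ) (x : Qubits 0) : τ x x = 1 := by
    have := hτ.2
    rw [Matrix.trace, Fintype.sum_subsingleton _ x] at this
    exact this
  ext x y
  rw [Subsingleton.elim x y, h ρ hρ, h σ hσ]

theorem Distinguisher.expect_nonneg (A : Distinguisher G n) {ρ : QOp n} (hρ : IsDensity ρ) :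
    0 ≤ A.expect ρ := by
  rw [A.expect_eq]
  exact trace_mul_re_nonneg A.effect_posSemidef hρ.1

theorem Distinguisher.expect_le_one (A : Distinguisher G n) {ρ : QOp n} (hρ : IsDensity ρ) :
    A.expect ρ ≤ 1 := by
  rw [A.expect_eq]
  exact trace_mul_density_le (by simpa using A.one_sub_effect_posSemidef) hρ

variable (G) in
/-- The effects of the distinguishers of size at most `s`, and their complements. -/
def effects (n s : ℕ) : Set (QOp n) :=
  {M | ∃ A : Distinguisher G n, A.size ≤ s ∧ (M = A.effect ∨ M = 1 - A.effect)}

theorem effects_posSemidef {s : ℕ} {M : QOp n} (h : M ∈ effects G n s) :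
    M.PosSemidef ∧ (1 - M).PosSemidef := by
  obtain ⟨A, -, rfl | rfl⟩ := h
  · exact ⟨A.effect_posSemidef, A.one_sub_effect_posSemidef⟩
  · exact ⟨A.one_sub_effect_posSemidef, by simpa using A.effect_posSemidef⟩

/-- Since `1 ≤ s`, the additive constants are absorbed and the cost is a constant multiple of `s`.
-/
theorem effects_controlledTest {cs cn K s : ℕ}
    (hF : ImplWithin G cs (basisMap (controlledSwap 0 1 2) : WireOp (Fin 3)))
    (hN : ImplWithin G cn notGate) (hK : ∀ g, G.arity g ≤ K) (hn : 0 < n) (hs : 1 ≤ s)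
    {M : QOp n} (h : M ∈ effects G n s) :
    ControlledTest G (⟨0, hn⟩ : Fin n) (s * (2 * ((K + 1) * cs) + 1 + cn)) M := by
  obtain ⟨A, hA, hM⟩ := h
  have hb : 2 * ((K * A.size + 1) * cs) + A.size + cn ≤ s * (2 * ((K + 1) * cs) + 1 + cn) := by
    have h1 : K * A.size + 1 ≤ s * (K + 1) := by nlinarith
    have h2 := Nat.mul_le_mul_right cs h1
    have h3 : cn ≤ s * cn := Nat.le_mul_of_pos_left _ hs
    nlinarith
  obtain rfl | rfl := hM
  · refine (A.controlledTest hF hK hn).mono (le_trans ?_ hb)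
    nlinarith
  · exact (A.controlledTest_compl hF hN hK hn).mono hb

/-- Indistinguishability is two-sided, while the metric condition is one-sided. A negative advantage
is reversed by the complementary effect, the two traces being equal. -/
theorem exists_mem_effects {s : ℕ} {ε : ℝ} {ρ σ : QOp n} (hρ : IsDensity ρ) (hσ : IsDensity σ)
    (h : ¬ Indist G s ε ρ σ) : ∃ M ∈ effects G n s, ε < (M * (ρ - σ)).trace.re := by
  unfold Indist at h
  push Not at h
  obtain ⟨A, hA, hlt⟩ := h
  rw [A.expect_eq, A.expect_eq] at hlt
  rcases lt_abs.1 hlt with h | h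
  · refine ⟨A.effect, ⟨A, hA, Or.inl rfl⟩, ?_⟩
    rwa [Matrix.mul_sub, Matrix.trace_sub, Complex.sub_re]
  · refine ⟨1 - A.effect, ⟨A, hA, Or.inr rfl⟩, ?_⟩
    rw [Matrix.sub_mul, Matrix.one_mul, Matrix.mul_sub, Matrix.trace_sub, Matrix.trace_sub,
      Matrix.trace_sub, hρ.2, hσ.2, sub_self, zero_sub, Complex.neg_re, Complex.sub_re]
    exact h

theorem log_two_mul_two_pow_le (hn : 0 < n) : Real.log (2 * 2 ^ n) ≤ 2 * n := by
  have h1 : (1 : ℝ) ≤ n := by exact_mod_cast hn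
  have h2 : Real.log 2 ≤ 1 := by linarith [Real.log_two_lt_d9]
  rw [← pow_succ', Real.log_pow]
  push_cast
  nlinarith [Real.log_nonneg (one_le_two (α := ℝ))]

/-- Short averages of small tests are as good as their convex combinations. -/
theorem exists_distinguisher_of_convex_combination {cs ch cn K s s' : ℕ}
    (hF : ImplWithin G cs (basisMap (controlledSwap 0 1 2) : WireOp (Fin 3)))
    (hH : ImplWithin G ch hadamardGate)
    (hN : ImplWithin G cn notGate) (hK : ∀ g, G.arity g ≤ K) (hn : 0 < n) (hs' : 1 ≤ s')
    {ε : ℝ} (hε : 0 < ε) (hε1 : ε < 1 / 2)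
    (hs : (s' : ℝ) * (128 * (2 * ((K + 1) * cs) + 1 + cn + (cs + ch) + cn : ℕ) * (n / ε ^ 2)) ≤ s)
    {ι : Type} [Fintype ι] (p : ι → ℝ) (hp : ∀ i, 0 ≤ p i) (hp1 : ∑ i, p i = 1) (M : ι → QOp n)
    (hM : ∀ i, M i ∈ effects G n s') :
    ∃ A : Distinguisher G n, A.size ≤ s ∧ ∀ ρ σ : QOp n, IsDensity ρ → IsDensity σ →
      ((∑ i, (p i : ℂ) • M i) * (ρ - σ)).trace.re - ε ≤ A.expect ρ - A.expect σ := by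
  have hn1 : (1 : ℝ) ≤ n := by exact_mod_cast hn
  -- Accuracy `δ = ε / 2` requires `8 * Real.log (2 * 2 ^ n)`, which is at most `16 * n`, to be
  -- bounded by the number of terms times `ε ^ 2 / 4`. The number of terms is the power of two `2 ^
  -- q` between `T` and `2 * T`, whence the factor 128.
  set T : ℝ := 64 * n / ε ^ 2 with hT
  have hT1 : 1 ≤ T := by
    rw [hT, le_div_iff₀ (by positivity)]
    nlinarith
  obtain ⟨r, hr1, hr2⟩ := exists_nat_pow_near hT1 (one_lt_two)
  set q := r + 1
  have hq : (2 : ℝ) ^ q ≤ 2 * T := by rw [pow_succ]; linarith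
  have hcard : (Fintype.card (Qubits n) : ℝ) = 2 ^ n := by simp
  obtain ⟨f, hf1, hf2⟩ := exists_average_close p hp hp1 M (fun i => (effects_posSemidef (hM i)).1)
    (fun i => (effects_posSemidef (hM i)).2) (δ := ε / 2) (by positivity) (by linarith) (2 ^ q)
    (by positivity) (by
      rw [hcard]
      push_cast
      have h1 := log_two_mul_two_pow_le hn
      have h2 : T * (ε / 2) ^ 2 = 16 * n := by
        rw [hT]; field_simp; ring
      have h3 : T * (ε / 2) ^ 2 ≤ 2 ^ q * (ε / 2) ^ 2 := by gcongr
      linarith)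
  obtain ⟨k, hk, hct⟩ := ControlledTest.average hF hH q (fun i => M (f i))
    (fun i _ => effects_controlledTest hF hN hK hn hs' (hM (f i)))
  obtain ⟨A, hA, hAe⟩ := hct.exists_distinguisher hN
  refine ⟨A, ?_, fun ρ σ hρ hσ => ?_⟩
  · set c := 2 * ((K + 1) * cs) + 1 + cn with hc
    have h1 : A.size ≤ 2 ^ q * (s' * (c + (cs + ch) + cn)) := by
      have h2 : cs + ch ≤ s' * (cs + ch) := Nat.le_mul_of_pos_left _ hs'
      have h3 : cn ≤ 2 ^ q * (s' * cn) := by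
        rw [← mul_assoc]
        exact Nat.le_mul_of_pos_left _ (by positivity)
      have h4 : 2 ^ q * (s' * c + (cs + ch)) ≤ 2 ^ q * (s' * c + s' * (cs + ch)) := by gcongr
      calc A.size ≤ k + cn := hA
        _ ≤ 2 ^ q * (s' * c + s' * (cs + ch)) + 2 ^ q * (s' * cn) := by omega
        _ = _ := by ring
    have h2 : (A.size : ℝ) ≤ 2 ^ q * (s' * (c + (cs + ch) + cn : ℕ)) := by exact_mod_cast h1
    have h3 : (2 : ℝ) ^ q * (s' * (c + (cs + ch) + cn : ℕ)) ≤
        (2 * T) * (s' * (c + (cs + ch) + cn : ℕ)) := by gcongr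
    have h4 : (2 * T) * (s' * (c + (cs + ch) + cn : ℕ)) =
        (s' : ℝ) * (128 * (c + (cs + ch) + cn : ℕ) * (n / ε ^ 2)) := by
      rw [hT]; ring
    exact_mod_cast (h2.trans (h3.trans (h4.le.trans hs)))
  · rw [A.expect_eq, A.expect_eq, hAe, ← Complex.sub_re, ← Matrix.trace_sub, ← Matrix.mul_sub]
    push_cast at hf1 hf2
    set D := ∑ i, (p i : ℂ) • M i - ((2 : ℂ) ^ q)⁻¹ • ∑ k ∈ Finset.range (2 ^ q), M (f k) with hD
    -- Each of the two states contributes an error of at most `ε / 2`.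
    have h1 := trace_mul_density_le (δ := ε / 2) (D := D) (by push_cast; exact hf1) hρ
    have h2 := trace_mul_density_le (δ := ε / 2) (D := -D)
      (by push_cast; rw [sub_neg_eq_add]; exact hf2) hσ
    have e : ∑ i, (p i : ℂ) • M i =
        D + ((2 : ℂ) ^ q)⁻¹ • ∑ k ∈ Finset.range (2 ^ q), M (f k) := by rw [hD]; abel
    rw [e, Matrix.add_mul, Matrix.trace_add, Complex.add_re, Matrix.mul_sub D, Matrix.trace_sub,
      Complex.sub_re]
    rw [Matrix.neg_mul, Matrix.trace_neg, Complex.neg_re] at h2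
    linarith

theorem exists_indist {cs ch cn K s s' : ℕ}
    (hF : ImplWithin G cs (basisMap (controlledSwap 0 1 2) : WireOp (Fin 3)))
    (hH : ImplWithin G ch hadamardGate)
    (hN : ImplWithin G cn notGate) (hK : ∀ g, G.arity g ≤ K) (hs' : 1 ≤ s')
    {ε : ℝ} (hε : 0 < ε)
    (hs : (s' : ℝ) * (128 * (2 * ((K + 1) * cs) + 1 + cn + (cs + ch) + cn : ℕ) * (n / ε ^ 2)) ≤ s)
    {β : QOp n} (hβ : IsDensity β) {L : Set (QOp n)} (hL : ∀ τ ∈ L, IsDensity τ)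
    (hconv : Convex ℝ L) (hcomp : IsCompact L)
    (hmet : ∀ A : Distinguisher G n, A.size ≤ s → ∃ τ ∈ L, A.expect β - A.expect τ < ε) :
    ∃ τ ∈ L, Indist G s' (2 * ε) β τ := by
  have hne : L.Nonempty := by
    -- The empty circuit with one ancilla, which keeps the work space nonempty even when `n = 0`.
    obtain ⟨τ, hτ, -⟩ := hmet ⟨1, by omega, []⟩ (Nat.zero_le _)
    exact ⟨τ, hτ⟩
  rcases Nat.eq_zero_or_pos n with rfl | hn
  · obtain ⟨τ, hτ⟩ := hne
    refine ⟨τ, hτ, fun A _ => ?_⟩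
    rw [isDensity_unique β τ hβ (hL τ hτ), sub_self, abs_zero]
    positivity
  -- For `1 / 2 ≤ ε` the tolerance `2 * ε` is at least 1, and probabilities never differ by more.
  rcases le_or_gt (1 / 2) ε with hε1 | hε1
  · obtain ⟨τ, hτ⟩ := hne
    refine ⟨τ, hτ, fun A _ => ?_⟩
    rw [abs_le]
    constructor <;> linarith [A.expect_nonneg hβ, A.expect_le_one hβ, A.expect_nonneg (hL τ hτ),
      A.expect_le_one (hL τ hτ)]
  · by_contra! hcon
    obtain ⟨ι, _, M, p, hM, hp, hp1, hgt⟩ := exists_convex_combination hconv hcomp hne β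
      (effects G n s') (2 * ε) fun τ hτ => exists_mem_effects hβ (hL τ hτ) (hcon τ hτ)
    obtain ⟨A, hA, hAd⟩ := exists_distinguisher_of_convex_combination hF hH hN hK hn hs' hε hε1 hs p
      hp hp1 M hM
    obtain ⟨τ, hτ, hlt⟩ := hmet A hA
    linarith [hAd β τ hβ (hL τ hτ), hgt τ hτ]

end Main

end

theorem mainTheorem11 (G : GateSet)
    (hNot : G.Implements notGate) (hHad : G.Implements hadamardGate)
    (hTof : G.Implements toffoliGate) :
    ∃ C : ℝ, 0 < C ∧
      ∀ (n N : ℕ), N = 2 ^ n →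
      ∀ (ρ σ : QOp n), IsDensity ρ → IsDensity σ →
      ∀ (s s' : ℕ) (ε l : ℝ), 1 ≤ s' → 0 < ε →
        (s' : ℝ) * (C * (Real.logb 2 N / ε ^ 2)) ≤ s →
          (Metric1Le G s ε ρ σ l → HILL1Le G s' (2 * ε) ρ σ l) ∧
          (Metric2Le G s ε ρ σ l → HILL2Le G s' (2 * ε) ρ σ l) := by
  obtain ⟨cs, hF⟩ := exists_fredkin_implWithin hTof
  obtain ⟨ch, hH⟩ := hHad.exists_implWithin
  obtain ⟨cn, hN⟩ := hNot.exists_implWithin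
  obtain ⟨K, hK⟩ := G.bounded
  -- Per term and per unit of `s'`: the controlled test with its possible complement, then one coin
  -- (`cs + ch`), then the NOT that raises the flag (`cn`).
  refine ⟨128 * (2 * ((K + 1) * cs) + 1 + cn + (cs + ch) + cn : ℕ), by positivity, ?_⟩
  rintro n N rfl ρ σ hρ hσ s s' ε l hs' hε hs
  have hlog : Real.logb 2 ((2 ^ n : ℕ) : ℝ) = n := by
    push_cast
    rw [← Real.rpow_natCast, Real.logb_rpow (by norm_num) (by norm_num)]
  rw [hlog] at hs
  set c : ℝ := (2 : ℝ) ^ l with hc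
  constructor
  · intro h
    have hmet : ∀ A : Distinguisher G n, A.size ≤ s →
        ∃ τ ∈ {τ : QOp n | IsDensity τ} ∩ {τ | ((c : ℂ) • σ - τ).PosSemidef},
          A.expect ρ - A.expect τ < ε := by
      intro A hA
      obtain ⟨τ, h1, h2, h3⟩ := h A hA
      exact ⟨τ, ⟨h1, (relMinEntropy_le_iff hσ.1 l).1 h2⟩, h3⟩
    have hcl : IsClosed {τ : QOp n | ((c : ℂ) • σ - τ).PosSemidef} :=
      isClosed_posSemidef.preimage (f := fun τ : QOp n => (c : ℂ) • σ - τ) (by fun_prop)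
    have hcv : Convex ℝ {τ : QOp n | ((c : ℂ) • σ - τ).PosSemidef} := by
      intro x hx y hy a b ha hb hab
      have e : (c : ℂ) • σ - (a • x + b • y) = a • ((c : ℂ) • σ - x) + b • ((c : ℂ) • σ - y) := by
        conv_lhs => rw [← one_smul ℝ ((c : ℂ) • σ), ← hab, add_smul]
        rw [smul_sub, smul_sub]; abel
      change ((c : ℂ) • σ - (a • x + b • y)).PosSemidef
      rw [e]
      exact (Matrix.PosSemidef.smul hx ha).add (Matrix.PosSemidef.smul hy hb)
    obtain ⟨τ, hτ, hI⟩ := exists_indist hF hH hN hK hs' hε hs hρ (fun τ hτ => hτ.1)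
      (convex_isDensity.inter hcv) (isCompact_isDensity.inter_right hcl) hmet
    exact ⟨τ, hτ.1, hI, (relMinEntropy_le_iff hσ.1 l).2 hτ.2⟩
  · intro h
    have hmet : ∀ A : Distinguisher G n, A.size ≤ s →
        ∃ τ ∈ {τ : QOp n | IsDensity τ} ∩ {τ | ((c : ℂ) • τ - ρ).PosSemidef},
          A.expect σ - A.expect τ < ε := by
      intro A hA
      obtain ⟨τ, h1, h2, h3⟩ := h A hA
      exact ⟨τ, ⟨h1, (relMinEntropy_le_iff h1.1 l).1 h2⟩, h3⟩
    have hcl : IsClosed {τ : QOp n | ((c : ℂ) • τ - ρ).PosSemidef} :=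
      isClosed_posSemidef.preimage (f := fun τ : QOp n => (c : ℂ) • τ - ρ) (by fun_prop)
    have hcv : Convex ℝ {τ : QOp n | ((c : ℂ) • τ - ρ).PosSemidef} := by
      intro x hx y hy a b ha hb hab
      have e : (c : ℂ) • (a • x + b • y) - ρ = a • ((c : ℂ) • x - ρ) + b • ((c : ℂ) • y - ρ) := by
        conv_lhs => rw [← one_smul ℝ ρ, ← hab, add_smul]
        rw [smul_sub, smul_sub, smul_add, smul_comm a, smul_comm b]; abel
      change ((c : ℂ) • (a • x + b • y) - ρ).PosSemidef
      rw [e]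
      exact (Matrix.PosSemidef.smul hx ha).add (Matrix.PosSemidef.smul hy hb)
    obtain ⟨τ, hτ, hI⟩ := exists_indist hF hH hN hK hs' hε hs hσ (fun τ hτ => hτ.1)
      (convex_isDensity.inter hcv) (isCompact_isDensity.inter_right hcl) hmet
    exact ⟨τ, hτ.1, hI, (relMinEntropy_le_iff hτ.1.1 l).2 hτ.2⟩
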